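/- **Setting.** Let $\mathcal Z$ be a complex separable Hilbert space (scalar product antilinear in the first variable), $\bigvee^n\mathcal Z$ its $n$-fold symmetric Hilbert tensor power, $\mathcal H=\bigoplus_{n\in\mathbb N}\bigvee^n\mathcal Z$ the symmetric Fock space (Hilbert direct sum) and $\mathcal H_0=\bigoplus^{\rm alg}_{n}\bigvee^n\mathcal Z$. For $p,q\in\mathbb N$ let $\mathcal P_{p,q}(\mathcal Z)$ be the space of polynomials $b(z)=\langle z^{\otimes q},\tilde b\,z^{\otimes p}\rangle$ with $\tilde b\in\mathcal L(\bigvee^p\mathcal Z,\bigvee^q\mathcal Z)$, and $\mathcal P^\infty_{p,q}(\mathcal Z)$ the subspace where $\tilde b$ is compact. For $\varepsilon>0$ the Wick quantization of $b\in\mathcal P_{p,q}(\mathcal Z)$ is the operator $b^{Wick}:\mathcal H_0\to\mathcal H_0$ with $$b^{Wick}_{|\bigvee^n\mathcal Z}=1_{[p,\infty)}(n)\,\frac{\sqrt{n!\,(n+q-p)!}}{(n-p)!}\,\varepsilon^{\frac{p+q}2}\,\mathcal S_{n-p+q}\big(\tilde b\otimes I_{\bigvee^{n-p}\mathcal Z}\big),$$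 where $\mathcal S_m$ is the orthogonal projection of $\bigotimes^m\mathcal Z$ onto $\bigvee^m\mathcal Z$; it is extended linearly to $b\in\bigoplus^{\rm alg}_{p,q}\mathcal P_{p,q}(\mathcal Z)$. The number operator $N=N_\varepsilon$ is multiplication by $\varepsilon n$ on $\bigvee^n\mathcal Z$. For a contraction $P\in\mathcal L(\mathcal Z)$, $\Gamma(P)\in\mathcal L(\mathcal H)$ is given by $\Gamma(P)_{|\bigvee^n\mathcal Z}=P\otimes\cdots\otimes P$. Let $\varepsilon_n>0$ with $\varepsilon_n\to0$, and let $\rho_{\varepsilon_n}$ be operators on $\mathcal H$ with $\rho_{\varepsilon_n}\ge0$, ${\rm Tr}[\rho_{\varepsilon_n}]=1$; $b^{Wick}$ and $N$ below are taken with $\varepsilon=\varepsilon_n$. Assume * **(H0)** there is $\lambda>0$ such that ${\rm Tr}[N^k\rho_{\varepsilon_n}]\le\lambda^k$ for all $k,n\in\mathbb N$; * the Borel probability measure $\mu$ on $\mathcal Z$ is the Wigner measure of $(\rho_{\varepsilon_n})_n$, that is, every $b\in\bigoplus^{\rm alg}_{p,q}\mathcal P^\infty_{p,q}(\mathcal Z)$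 is $\mu$-integrable and $\lim_{n\to\infty}{\rm Tr}[\rho_{\varepsilon_n}b^{Wick}]=\int_{\mathcal Z}b\,d\mu$. Consider the conditions * **(P)** every $b\in\bigoplus^{\rm alg}_{p,q}\mathcal P_{p,q}(\mathcal Z)$ is $\mu$-integrable and $\lim_{n\to\infty}{\rm Tr}[\rho_{\varepsilon_n}b^{Wick}]=\int_{\mathcal Z}b\,d\mu$; * **(T)** for every $\eta>0$ there is a finite rank orthogonal projector $P\in\mathcal L(\mathcal Z)$ such that ${\rm Tr}[(1-\Gamma(P))\rho_{\varepsilon_n}]<\eta$ for all $n\in\mathbb N$; * **(E)** for all $p,q\in\mathbb N$ and $\eta>0$ there is a neighborhood $\mathcal W_0$ of zero in $\mathcal L(\bigvee^p\mathcal Z,\bigvee^q\mathcal Z)$, endowed with the $\sigma$-weak topology, such that $|{\rm Tr}[\rho_{\varepsilon_n}b^{Wick}]|<\eta$ for all $\tilde b\in\mathcal W_0$ and all $n\in\mathbb N$. **Lemma.** Under these assumptions, (i) (T) implies (P); (ii) (E) implies (P). -/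

import Mathlib

open scoped ENNReal InnerProductSpace Topology DirectSum

noncomputable section

-- In this section `inner ℂ` is found through `InnerProductSpace` (not through `CStarModule`).
attribute [-instance] CStarModule.toInner

namespace Fock

/-! ### Hilbert tensor products in coordinates

`ℓ²(α × β)` is the Hilbert tensor product of `ℓ²(α)` and `ℓ²(β)`, and `ℓ²(Fin n → ι)` is the
`n`-fold Hilbert tensor power of `ℓ²(ι)`.  A Hilbert space with a Hilbert basis indexed by `ι`
is identified with `ℓ²(ι)`. -/

/-- The Hilbert space `ℓ²(α)`. -/
abbrev L2 (α : Type*) := lp (fun _ : α => ℂ) 2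

instance (α : Type*) : InnerProductSpace ℂ (L2 α) := lp.instInnerProductSpace
instance (α : Type*) : NormedSpace ℂ (L2 α) := InnerProductSpace.toNormedSpace
instance (α : Type*) : Module ℂ (L2 α) := NormedSpace.toModule
instance (α : Type*) : Inner ℂ (L2 α) := InnerProductSpace.toInner

theorem L2.summable_sq {α : Type*} (x : L2 α) : Summable fun i => ‖x i‖ ^ (2 : ℕ) := by
  have h := (memℓp_gen_iff (p := 2) (by norm_num)).1 (lp.memℓp x)
  simpa using h

theorem L2.norm_sq {α : Type*} (x : L2 α) : ‖x‖ ^ (2 : ℕ) = ∑' i, ‖x i‖ ^ (2 : ℕ) := by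
  have h := lp.norm_rpow_eq_tsum (p := 2) (by norm_num) x
  simpa using h

theorem memL2_of_summable {α : Type*} {f : α → ℂ} (h : Summable fun i => ‖f i‖ ^ (2 : ℕ)) :
    Memℓp (E := fun _ : α => ℂ) f 2 := by
  refine (memℓp_gen_iff (p := 2) (by norm_num)).2 ?_
  simpa using h

/-- Relabelling of coordinates along a bijection, `(reindex e ψ)(b) = ψ(e⁻¹ b)`. -/
def reindex {α β : Type*} (e : α ≃ β) : L2 α →L[ℂ] L2 β :=
  LinearMap.mkContinuous
    { toFun := fun ψ => ⟨fun b => ψ (e.symm b),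
        memL2_of_summable (e.symm.summable_iff.2 (L2.summable_sq ψ))⟩
      map_add' := fun _ _ => rfl
      map_smul' := fun _ _ => rfl } 1
    (fun ψ => by
      refine (pow_le_pow_iff_left₀ (norm_nonneg _) (by positivity) two_ne_zero).1 ?_
      rw [one_mul, L2.norm_sq, L2.norm_sq]
      exact (e.symm.tsum_eq (fun i => ‖ψ i‖ ^ (2 : ℕ))).le)

/-- The slice `ψ(·, c)` of `ψ ∈ ℓ²(α × γ)`. -/
def slice {α γ : Type*} (c : γ) : L2 (α × γ) →ₗ[ℂ] L2 α where
  toFun ψ := ⟨fun a => ψ (a, c), memL2_of_summable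
    ((L2.summable_sq ψ).comp_injective (fun _ _ h => (Prod.ext_iff.1 h).1))⟩
  map_add' _ _ := rfl
  map_smul' _ _ := rfl

theorem hasSum_slice {α γ : Type*} (ψ : L2 (α × γ)) :
    HasSum (fun c => ‖slice c ψ‖ ^ (2 : ℕ)) (‖ψ‖ ^ (2 : ℕ)) := by
  have h1 := (Equiv.prodComm γ α).summable_iff.2 (L2.summable_sq ψ)
  have h2 : ∑' x : γ × α, ‖ψ (x.2, x.1)‖ ^ (2 : ℕ) = ‖ψ‖ ^ (2 : ℕ) := by
    rw [L2.norm_sq]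
    exact (Equiv.prodComm γ α).tsum_eq (fun i => ‖ψ i‖ ^ (2 : ℕ))
  have h3 := h1.hasSum.prod_fiberwise (fun c => (h1.prod_factor c).hasSum)
  have h4 : (∑' x : γ × α, ((fun i => ‖ψ i‖ ^ (2 : ℕ)) ∘ (Equiv.prodComm γ α)) x)
      = ‖ψ‖ ^ (2 : ℕ) := h2
  rw [h4] at h3
  convert h3 using 2 with c
  rw [L2.norm_sq]
  rfl

theorem memL2_of_slices {α γ : Type*} (φ : γ → L2 α) (h : Summable fun c => ‖φ c‖ ^ (2 : ℕ)) :
    Summable fun x : α × γ => ‖φ x.2 x.1‖ ^ (2 : ℕ) := by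
  refine (Equiv.prodComm γ α).summable_iff.1 ?_
  refine (summable_prod_of_nonneg (fun _ => sq_nonneg _)).2 ⟨fun c => L2.summable_sq (φ c), ?_⟩
  refine h.congr fun c => ?_
  rw [L2.norm_sq]
  rfl

theorem hasSum_sq_of_slices {α γ : Type*} (φ : γ → L2 α)
    (h : Summable fun c => ‖φ c‖ ^ (2 : ℕ)) :
    HasSum (fun x : α × γ => ‖φ x.2 x.1‖ ^ (2 : ℕ)) (∑' c, ‖φ c‖ ^ (2 : ℕ)) := by
  have h1 := (Equiv.prodComm γ α).summable_iff.2 (memL2_of_slices φ h)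
  have h3 := h1.hasSum.prod_fiberwise (fun c => (h1.prod_factor c).hasSum)
  have h4 : ∀ c, (∑' a, ((fun x : α × γ => ‖φ x.2 x.1‖ ^ (2 : ℕ)) ∘ Equiv.prodComm γ α) (c, a))
      = ‖φ c‖ ^ (2 : ℕ) := fun c => (L2.norm_sq (φ c)).symm
  simp only [h4] at h3
  rw [h3.tsum_eq]
  exact (Equiv.prodComm γ α).hasSum_iff.1 h1.hasSum

theorem sq_slice_le {α β γ : Type*} (A : L2 α →L[ℂ] L2 β) (ψ : L2 (α × γ)) (c : γ) :
    ‖A (slice c ψ)‖ ^ (2 : ℕ) ≤ ‖A‖ ^ (2 : ℕ) * ‖slice c ψ‖ ^ (2 : ℕ) := by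
  rw [← mul_pow]
  exact pow_le_pow_left₀ (norm_nonneg _) (A.le_opNorm _) 2

theorem summable_sq_slice {α β γ : Type*} (A : L2 α →L[ℂ] L2 β) (ψ : L2 (α × γ)) :
    Summable fun c => ‖A (slice c ψ)‖ ^ (2 : ℕ) :=
  Summable.of_nonneg_of_le (fun _ => by positivity) (sq_slice_le A ψ)
    ((hasSum_slice ψ).summable.mul_left _)

/-- `A ⊗ I` as a linear map, acting as `A` on each slice. -/
def tensorIdLin {α β : Type*} (γ : Type*) (A : L2 α →L[ℂ] L2 β) :
    L2 (α × γ) →ₗ[ℂ] L2 (β × γ) where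
  toFun ψ := ⟨fun x => A (slice x.2 ψ) x.1,
    memL2_of_summable (memL2_of_slices (fun c => A (slice c ψ)) (summable_sq_slice A ψ))⟩
  map_add' ψ φ := by
    refine lp.ext (funext fun x => ?_)
    change A (slice x.2 (ψ + φ)) x.1 = A (slice x.2 ψ) x.1 + A (slice x.2 φ) x.1
    rw [map_add, map_add]
    rfl
  map_smul' a ψ := by
    refine lp.ext (funext fun x => ?_)
    change A (slice x.2 (a • ψ)) x.1 = a • A (slice x.2 ψ) x.1
    rw [map_smul, map_smul]
    rfl

theorem norm_tensorIdLin_le {α β γ : Type*} (A : L2 α →L[ℂ] L2 β) (ψ : L2 (α × γ)) :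
    ‖tensorIdLin γ A ψ‖ ≤ ‖A‖ * ‖ψ‖ := by
  refine (pow_le_pow_iff_left₀ (norm_nonneg _) (by positivity) two_ne_zero).1 ?_
  have h := (hasSum_sq_of_slices (fun c => A (slice c ψ)) (summable_sq_slice A ψ)).tsum_eq
  have h' : ‖tensorIdLin γ A ψ‖ ^ (2 : ℕ) = ∑' c, ‖A (slice c ψ)‖ ^ (2 : ℕ) := by
    rw [← h, L2.norm_sq]
    rfl
  rw [h', mul_pow, ← (hasSum_slice ψ).tsum_eq, ← tsum_mul_left]
  exact Summable.tsum_le_tsum (sq_slice_le A ψ) (summable_sq_slice A ψ)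
    ((hasSum_slice ψ).summable.mul_left _)

/-- `A ⊗ I : ℓ²(α × γ) → ℓ²(β × γ)`. -/
def tensorId {α β : Type*} (γ : Type*) (A : L2 α →L[ℂ] L2 β) : L2 (α × γ) →L[ℂ] L2 (β × γ) :=
  (tensorIdLin γ A).mkContinuous ‖A‖ (norm_tensorIdLin_le A)

theorem tensorId_apply {α β γ : Type*} (A : L2 α →L[ℂ] L2 β) (ψ : L2 (α × γ)) (b : β) (c : γ) :
    tensorId γ A ψ (b, c) = A (slice c ψ) b := rfl

theorem norm_tensorId_le {α β γ : Type*} (A : L2 α →L[ℂ] L2 β) : ‖tensorId γ A‖ ≤ ‖A‖ :=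
  LinearMap.mkContinuous_norm_le _ (norm_nonneg _) _

theorem norm_reindex_le {α β : Type*} (e : α ≃ β) : ‖reindex e‖ ≤ 1 :=
  LinearMap.mkContinuous_norm_le _ zero_le_one _

/-- `A ⊗ B = (A ⊗ I)(I ⊗ B)`. -/
def tensorMap {α β γ δ : Type*} (A : L2 α →L[ℂ] L2 β) (B : L2 γ →L[ℂ] L2 δ) :
    L2 (α × γ) →L[ℂ] L2 (β × δ) :=
  tensorId δ A ∘L reindex (Equiv.prodComm δ α) ∘L tensorId α B ∘L reindex (Equiv.prodComm α γ)

variable {ι : Type*}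

/-- The `n`-fold Hilbert tensor power of `ℓ²(ι)`. -/
abbrev TensorPow (ι : Type*) (n : ℕ) := L2 (Fin n → ι)

/-- `A^{⊗ n} = A ⊗ A ⊗ ⋯ ⊗ A`. -/
def tensorPowMap (A : L2 ι →L[ℂ] L2 ι) : (n : ℕ) → TensorPow ι n →L[ℂ] TensorPow ι n
  | 0 => ContinuousLinearMap.id ℂ _
  | n + 1 => reindex (Fin.consEquiv fun _ => ι) ∘L tensorMap A (tensorPowMap A n) ∘L
      reindex (Fin.consEquiv fun _ => ι).symm

theorem norm_tensorPowMap_le (A : L2 ι →L[ℂ] L2 ι) (n : ℕ) : ‖tensorPowMap A n‖ ≤ ‖A‖ ^ n := by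
  induction n with
  | zero => simpa [tensorPowMap] using ContinuousLinearMap.norm_id_le
  | succ n ih =>
    refine ContinuousLinearMap.opNorm_le_bound _ (by positivity) fun ψ => ?_
    have hr : ∀ {α β : Type _} (e : α ≃ β) (φ : L2 α), ‖reindex e φ‖ ≤ ‖φ‖ := fun e φ => by
      simpa using (reindex e).le_of_opNorm_le (norm_reindex_le e) φ
    have hA : ∀ {γ : Type _} (φ : L2 (ι × γ)), ‖tensorId γ A φ‖ ≤ ‖A‖ * ‖φ‖ := fun φ =>
      (tensorId _ A).le_of_opNorm_le (norm_tensorId_le A) φ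
    have hB : ∀ {γ : Type _} (φ : L2 ((Fin n → ι) × γ)),
        ‖tensorId γ (tensorPowMap A n) φ‖ ≤ ‖A‖ ^ n * ‖φ‖ := fun φ =>
      (tensorId _ (tensorPowMap A n)).le_of_opNorm_le ((norm_tensorId_le _).trans ih) φ
    simp only [tensorPowMap, tensorMap, ContinuousLinearMap.comp_apply]
    refine (hr _ _).trans ((hA _).trans ?_)
    rw [pow_succ', mul_assoc]
    gcongr
    exact (hr _ _).trans ((hB _).trans (by gcongr; exact (hr _ _).trans (hr _ _)))

/-! ### Symmetric tensor powers -/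

/-- The tensors that are invariant under all permutations of the `n` factors. -/
def symSubmodule (ι : Type*) (n : ℕ) : Submodule ℂ (TensorPow ι n) where
  carrier := {ψ | ∀ (σ : Equiv.Perm (Fin n)) (i : Fin n → ι), ψ (i ∘ σ) = ψ i}
  add_mem' hψ hφ σ i := congrArg₂ (· + ·) (hψ σ i) (hφ σ i)
  zero_mem' _ _ := rfl
  smul_mem' a _ hψ σ i := congrArg (a • ·) (hψ σ i)

theorem isClosed_symSubmodule (n : ℕ) : IsClosed (symSubmodule ι n : Set (TensorPow ι n)) := by
  have : (symSubmodule ι n : Set (TensorPow ι n)) = ⋂ (σ : Equiv.Perm (Fin n)) (i : Fin n → ι),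
      {ψ | lp.evalCLM ℂ (fun _ : Fin n → ι => ℂ) 2 (i ∘ σ) ψ
        = lp.evalCLM ℂ (fun _ : Fin n → ι => ℂ) 2 i ψ} := by
    ext ψ
    simp only [Set.mem_iInter]
    rfl
  rw [this]
  exact isClosed_iInter fun σ => isClosed_iInter fun i =>
    isClosed_eq (ContinuousLinearMap.continuous _) (ContinuousLinearMap.continuous _)

instance (n : ℕ) : CompleteSpace (symSubmodule ι n) := (isClosed_symSubmodule n).completeSpace_coe

/-- The symmetric Hilbert tensor power `⋁ⁿ`: the closed subspace `symSubmodule ι n` of the tensor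
power, as a Hilbert space. -/
def SymPow (ι : Type*) (n : ℕ) : Type _ := symSubmodule ι n

instance (n : ℕ) : NormedAddCommGroup (SymPow ι n) :=
  Submodule.normedAddCommGroup (symSubmodule ι n)

instance (n : ℕ) : InnerProductSpace ℂ (SymPow ι n) :=
  Submodule.innerProductSpace (symSubmodule ι n)

instance (n : ℕ) : Inner ℂ (SymPow ι n) := InnerProductSpace.toInner

instance (n : ℕ) : CompleteSpace (SymPow ι n) :=
  inferInstanceAs (CompleteSpace (symSubmodule ι n))

/-- The inclusion of `⋁ⁿ` in the tensor power. -/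
def incl (n : ℕ) : SymPow ι n →L[ℂ] TensorPow ι n := (symSubmodule ι n).subtypeL

/-- The symmetrization `𝒮ₙ`: the orthogonal projection of the `n`-fold tensor power onto `⋁ⁿ`. -/
def symmetrize (n : ℕ) : TensorPow ι n →L[ℂ] SymPow ι n :=
  (symSubmodule ι n).orthogonalProjectionOnto

/-! ### Pure tensors -/

theorem hasSum_prod_pi {n : ℕ} (f : Fin n → ι → ℂ) (hf : ∀ k, Summable fun i => ‖f k i‖) :
    (Summable fun i : Fin n → ι => ‖∏ k, f k (i k)‖) ∧
      HasSum (fun i : Fin n → ι => ∏ k, f k (i k)) (∏ k, ∑' j, f k j) := by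
  induction n with
  | zero =>
    refine ⟨(hasSum_fintype _).summable, ?_⟩
    simp
  | succ n ih =>
    obtain ⟨h1, h2⟩ := ih (fun k => f k.succ) (fun k => hf k.succ)
    have h3 := summable_mul_of_summable_norm (hf 0) h1
    have h3' := (hf 0).mul_norm h1
    have h4 := (hf 0).of_norm.hasSum.mul h2 h3
    rw [← (Fin.consEquiv fun _ => ι).summable_iff, ← (Fin.consEquiv fun _ => ι).hasSum_iff]
    constructor
    · refine h3'.congr fun x => ?_
      simp only [Function.comp_apply, Fin.prod_univ_succ]
      rfl
    · rw [Fin.prod_univ_succ]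
      refine h4.congr_fun fun x => ?_
      simp only [Function.comp_apply, Fin.prod_univ_succ]
      rfl

/-- The pure tensor `x₁ ⊗ ⋯ ⊗ xₙ`. -/
def pureTensor {n : ℕ} (x : Fin n → L2 ι) : TensorPow ι n :=
  ⟨fun i => ∏ k, x k (i k), memL2_of_summable (by
    have h := (hasSum_prod_pi (fun k j => x k j ^ (2 : ℕ)) (fun k => by
      simpa using L2.summable_sq (x k))).1
    refine h.congr fun i => ?_
    simp [Finset.prod_pow])⟩

theorem pureTensor_apply {n : ℕ} (x : Fin n → L2 ι) (i : Fin n → ι) :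
    pureTensor x i = ∏ k, x k (i k) := rfl

/-- The inner product of pure tensors is the product of the inner products. -/
theorem inner_pureTensor {n : ℕ} (x y : Fin n → L2 ι) :
    inner ℂ (pureTensor x) (pureTensor y) = ∏ k, inner ℂ (x k) (y k) := by
  have h := (hasSum_prod_pi (fun k j => inner ℂ (x k j) (y k j)) (fun k => by
    refine Summable.of_nonneg_of_le (fun _ => norm_nonneg _) (fun j => norm_inner_le_norm _ _) ?_
    refine Summable.of_nonneg_of_le (fun _ => by positivity) (fun j => ?_)
      ((L2.summable_sq (x k)).add (L2.summable_sq (y k)))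
    nlinarith [sq_nonneg (‖x k j‖ - ‖y k j‖), sq_nonneg ‖x k j‖, sq_nonneg ‖y k j‖])).2
  simp only [lp.inner_eq_tsum]
  rw [← h.tsum_eq]
  refine tsum_congr fun i => ?_
  simp [pureTensor_apply, Finset.prod_mul_distrib]

/-- Pure tensors span a dense subspace. -/
theorem dense_span_pureTensor (n : ℕ) :
    Dense (Submodule.span ℂ (Set.range (pureTensor (ι := ι) (n := n))) : Set (TensorPow ι n)) := by
  classical
  refine fun ψ => mem_closure_of_tendsto (lp.hasSum_single (by norm_num) ψ)
    (Filter.Eventually.of_forall fun s => Submodule.sum_mem _ fun i _ => ?_)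
  have : lp.single 2 i (ψ i) = ψ i • pureTensor fun k => lp.single 2 (i k) (1 : ℂ) := by
    refine lp.ext (funext fun j => ?_)
    by_cases hj : j = i
    · subst hj
      simp [pureTensor_apply]
    · obtain ⟨k, hk⟩ := Function.ne_iff.1 hj
      rw [lp.single_apply_ne _ _ _ hj, lp.coeFn_smul, Pi.smul_apply, pureTensor_apply,
        Finset.prod_eq_zero (Finset.mem_univ k) (lp.single_apply_ne _ _ _ hk), smul_zero]
  rw [this]
  exact Submodule.smul_mem _ _ (Submodule.subset_span ⟨_, rfl⟩)

variable {Z : Type*} [NormedAddCommGroup Z] [InnerProductSpace ℂ Z]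

/-- `z^{⊗ n} ∈ ⋁ⁿ` for a vector `z` of a Hilbert space with Hilbert basis `e`. -/
def tensorPower (e : HilbertBasis ι ℂ Z) (n : ℕ) (z : Z) : SymPow ι n :=
  ⟨pureTensor fun _ => e.repr z, fun σ i => Equiv.prod_comp σ fun k => e.repr z (i k)⟩

/-! ### The symmetric Fock space -/

/-- The symmetric Fock space `ℋ = ⊕ₙ ⋁ⁿ`, a Hilbert direct sum. -/
abbrev FockSpace (ι : Type*) := lp (fun n => SymPow ι n) 2

instance : Inner ℂ (FockSpace ι) := InnerProductSpace.toInner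

/-- The finite-particle space `ℋ₀`: the algebraic direct sum of the `⋁ⁿ`. -/
abbrev FiniteFock (ι : Type*) := ⨁ n, SymPow ι n

/-- The inclusion of `ℋ₀` in `ℋ`. -/
def toFock : FiniteFock ι →ₗ[ℂ] FockSpace ι :=
  DirectSum.toModule ℂ ℕ (FockSpace ι) fun n => lp.lsingle (E := fun m => SymPow ι m) 2 n

/-! ### Wick quantization -/

/-- `ι^n = ι^p × ι^{n-p}`, that is `⊗ⁿ = (⊗ᵖ) ⊗ (⊗ⁿ⁻ᵖ)`. -/
def splitEquiv (ι : Type*) {p n : ℕ} (h : p ≤ n) :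
    (Fin n → ι) ≃ (Fin p → ι) × (Fin (n - p) → ι) :=
  (Equiv.arrowCongr ((finCongr (Nat.add_sub_of_le h).symm).trans finSumFinEquiv.symm)
    (Equiv.refl ι)).trans (Equiv.sumArrowEquivProdArrow _ _ _)

/-- `ι^q × ι^r = ι^{r+q}`, that is `(⊗^q) ⊗ (⊗^r) = ⊗^{r+q}`. -/
def joinEquiv (ι : Type*) (q r : ℕ) : (Fin q → ι) × (Fin r → ι) ≃ (Fin (r + q) → ι) :=
  (Equiv.sumArrowEquivProdArrow _ _ _).symm.trans
    (Equiv.arrowCongr (finSumFinEquiv.trans (finCongr (Nat.add_comm q r))) (Equiv.refl ι))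

/-- The restriction to `⋁ⁿ` of the Wick monomial with symbol `B = b̃ : ⋁ᵖ → ⋁^q`:
`1_{p ≤ n} √(n! (n-p+q)!) / (n-p)! ε^{(p+q)/2} 𝒮_{n-p+q} (B ⊗ I)`.
(`B` is composed with `𝒮_p`, which is the identity on `⋁ᵖ`, in order to be defined on `⊗ᵖ`.) -/
def wickSector (ε : ℝ) {p q : ℕ} (B : SymPow ι p →L[ℂ] SymPow ι q) (n : ℕ) :
    SymPow ι n →L[ℂ] SymPow ι (n - p + q) :=
  if h : p ≤ n then
    ((√((n.factorial : ℝ) * ((n - p + q).factorial : ℝ)) / ((n - p).factorial : ℝ)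
        * ε ^ (((p : ℝ) + (q : ℝ)) / 2) : ℝ) : ℂ) •
      (symmetrize (n - p + q) ∘L reindex (joinEquiv ι q (n - p)) ∘L
        tensorId (Fin (n - p) → ι) (incl q ∘L B ∘L symmetrize p) ∘L
        reindex (splitEquiv ι h) ∘L incl n)
  else 0

theorem wickSector_add (ε : ℝ) {p q : ℕ} (B C : SymPow ι p →L[ℂ] SymPow ι q) (n : ℕ) :
    wickSector ε (B + C) n = wickSector ε B n + wickSector ε C n := by
  unfold wickSector
  split_ifs with h
  · have : tensorId (Fin (n - p) → ι) (incl q ∘L (B + C) ∘L symmetrize p)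
        = tensorId (Fin (n - p) → ι) (incl q ∘L B ∘L symmetrize p)
        + tensorId (Fin (n - p) → ι) (incl q ∘L C ∘L symmetrize p) := rfl
    rw [this]
    refine ContinuousLinearMap.ext fun ψ => ?_
    simp only [smul_apply, add_apply,
      ContinuousLinearMap.comp_apply, map_add, smul_add]
  · simp

theorem wickSector_smul (ε : ℝ) {p q : ℕ} (a : ℂ) (B : SymPow ι p →L[ℂ] SymPow ι q) (n : ℕ) :
    wickSector ε (a • B) n = a • wickSector ε B n := by
  unfold wickSector
  split_ifs with h
  · have : tensorId (Fin (n - p) → ι) (incl q ∘L (a • B) ∘L symmetrize p)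
        = a • tensorId (Fin (n - p) → ι) (incl q ∘L B ∘L symmetrize p) := rfl
    rw [this]
    refine ContinuousLinearMap.ext fun ψ => ?_
    simp only [smul_apply, ContinuousLinearMap.comp_apply, map_smul]
    rw [smul_comm]
  · refine ContinuousLinearMap.ext fun ψ => ?_
    rw [smul_apply, zero_apply, smul_zero]

/-- The Wick monomial `b^{Wick} : ℋ₀ → ℋ₀`, depending linearly on `b̃`. -/
def wickMonomial (ε : ℝ) (p q : ℕ) :
    (SymPow ι p →L[ℂ] SymPow ι q) →ₗ[ℂ] FiniteFock ι →ₗ[ℂ] FiniteFock ι where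
  toFun B := DirectSum.toModule ℂ ℕ (FiniteFock ι) fun n =>
    DirectSum.lof ℂ ℕ (fun m => SymPow ι m) (n - p + q) ∘ₗ (wickSector ε B n).toLinearMap
  map_add' B C := by
    refine DirectSum.linearMap_ext _ fun n => LinearMap.ext fun ψ => ?_
    simp only [LinearMap.comp_apply, LinearMap.add_apply, DirectSum.toModule_lof, wickSector_add,
      ContinuousLinearMap.coe_coe, add_apply, map_add]
  map_smul' a B := by
    refine DirectSum.linearMap_ext _ fun n => LinearMap.ext fun ψ => ?_
    simp only [LinearMap.comp_apply, LinearMap.smul_apply, DirectSum.toModule_lof,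
      wickSector_smul, ContinuousLinearMap.coe_coe, smul_apply, map_smul,
      RingHom.id_apply]

/-- The algebraic direct sum `⊕_{p,q} 𝒫_{p,q}` of polynomial symbols.  A polynomial
`b(z) = ⟪z^{⊗ q}, b̃ z^{⊗ p}⟫` in `𝒫_{p,q}` is represented by its operator `b̃ : ⋁ᵖ → ⋁^q`. -/
abbrev Symbol (ι : Type*) := ⨁ pq : ℕ × ℕ, SymPow ι pq.1 →L[ℂ] SymPow ι pq.2

/-- The element of `𝒫_{p,q}` with operator `B`. -/
def Symbol.monomial {p q : ℕ} (B : SymPow ι p →L[ℂ] SymPow ι q) : Symbol ι :=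
  DirectSum.of (fun pq : ℕ × ℕ => SymPow ι pq.1 →L[ℂ] SymPow ι pq.2) (p, q) B

/-- Membership in `⊕_{p,q} 𝒫^∞_{p,q}`: all the operators `b̃_{p,q}` are compact. -/
def Symbol.IsCompact (b : Symbol ι) : Prop := ∀ pq : ℕ × ℕ, IsCompactOperator (b pq)

/-- The value `b(z) = ∑_{p,q} ⟪z^{⊗ q}, b̃_{p,q} z^{⊗ p}⟫`. -/
def Symbol.eval (e : HilbertBasis ι ℂ Z) (b : Symbol ι) (z : Z) : ℂ :=
  DirectSum.toModule ℂ (ℕ × ℕ) ℂ (fun pq =>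
    { toFun := fun B : SymPow ι pq.1 →L[ℂ] SymPow ι pq.2 =>
        inner ℂ (tensorPower e pq.2 z) (B (tensorPower e pq.1 z))
      map_add' := fun B C => by simp only [add_apply, inner_add_right]
      map_smul' := fun a B => by
        simp only [smul_apply, inner_smul_right, RingHom.id_apply, smul_eq_mul] }) b

/-- `b^{Wick} : ℋ₀ → ℋ₀` for `b` in the algebraic direct sum of the `𝒫_{p,q}`. -/
def wick (ε : ℝ) (b : Symbol ι) : FiniteFock ι →ₗ[ℂ] FiniteFock ι :=
  DirectSum.toModule ℂ (ℕ × ℕ) (FiniteFock ι →ₗ[ℂ] FiniteFock ι)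
    (fun pq => wickMonomial ε pq.1 pq.2) b

/-! ### Traces -/

section Trace

variable (E : Type*) [NormedAddCommGroup E] [InnerProductSpace ℂ E] [CompleteSpace E]

/-- The index set of a fixed Hilbert basis of `E`. -/
def basisIndex : Set E := (exists_hilbertBasis ℂ E).choose

/-- A fixed Hilbert basis of `E`. -/
def someBasis : HilbertBasis (basisIndex E) ℂ E := (exists_hilbertBasis ℂ E).choose_spec.choose

variable {E}

/-- `Tr[T] ∈ [0, ∞]` of a positive operator. -/
def posTrace (T : E →L[ℂ] E) : ℝ≥0∞ :=
  ∑' i, ENNReal.ofReal (inner ℂ (someBasis E i) (T (someBasis E i))).re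

/-- The trace of a trace class operator. -/
def trace (T : E →L[ℂ] E) : ℂ := ∑' i, inner ℂ (someBasis E i) (T (someBasis E i))

end Trace

/-- A density matrix: `ρ ≥ 0` and `Tr[ρ] = 1`. -/
def IsDensityMatrix (ρ : FockSpace ι →L[ℂ] FockSpace ι) : Prop :=
  ρ.IsPositive ∧ posTrace ρ = 1

/-- The block `⋁ⁿ → ⋁ⁿ` of an operator on the Fock space. -/
def block (ρ : FockSpace ι →L[ℂ] FockSpace ι) (n : ℕ) : SymPow ι n →L[ℂ] SymPow ι n :=
  lp.evalCLM ℂ (fun m => SymPow ι m) 2 n ∘L ρ ∘L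
    lp.singleContinuousLinearMap ℂ (fun m => SymPow ι m) 2 n

/-- `Tr[N^k ρ] ∈ [0, ∞]` for `ρ ≥ 0`.  The number operator `N = N_ε` is multiplication by `ε n` on
`⋁ⁿ`, so that this trace is the sum over `n` of `(ε n)^k` times the trace of the `n`-th block. -/
def numberMoment (ε : ℝ) (k : ℕ) (ρ : FockSpace ι →L[ℂ] FockSpace ι) : ℝ≥0∞ :=
  ∑' n : ℕ, ENNReal.ofReal ((ε * n) ^ k) * posTrace (block ρ n)

open Classical in
/-- The bounded extension to `ℋ` of an operator defined on the dense subspace `ℋ₀`; it is unique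
if it exists (and the value is `0` if there is none). -/
def boundedExtension (A : FiniteFock ι →ₗ[ℂ] FockSpace ι) : FockSpace ι →L[ℂ] FockSpace ι :=
  if h : ∃ T : FockSpace ι →L[ℂ] FockSpace ι, ∀ ψ, T (toFock ψ) = A ψ then h.choose else 0

/-- `Tr[ρ b^{Wick}]`.  If `ρ` is a density matrix with `Tr[N^k ρ] ≤ λ^k` for all `k`, then `ρ` lives
on finitely many of the spaces `⋁ⁿ`, so that `ρ b^{Wick}` has a bounded extension, which is of trace
class. -/
def wickTrace (ε : ℝ) (ρ : FockSpace ι →L[ℂ] FockSpace ι) (b : Symbol ι) : ℂ :=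
  trace (boundedExtension (ρ.toLinearMap ∘ₗ toFock ∘ₗ wick ε b))

/-! ### The second quantization `Γ(P)` -/

/-- An operator on the Hilbert space `Z`, in the coordinates of the Hilbert basis `e`. -/
def inCoordinates (e : HilbertBasis ι ℂ Z) (P : Z →L[ℂ] Z) : L2 ι →L[ℂ] L2 ι :=
  (e.repr.toContinuousLinearEquiv : Z →L[ℂ] L2 ι) ∘L P ∘L
    (e.repr.symm.toContinuousLinearEquiv : L2 ι →L[ℂ] Z)

theorem norm_inCoordinates_le (e : HilbertBasis ι ℂ Z) (P : Z →L[ℂ] Z) :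
    ‖inCoordinates e P‖ ≤ ‖P‖ := by
  refine ContinuousLinearMap.opNorm_le_bound _ (norm_nonneg _) fun x => ?_
  have h : ‖inCoordinates e P x‖ = ‖P (e.repr.symm x)‖ := e.repr.norm_map _
  rw [h, ← e.repr.symm.norm_map x]
  exact P.le_opNorm _

/-- `P ⊗ P ⊗ ⋯ ⊗ P` on `⋁ⁿ`.  (`P^{⊗ n}` maps symmetric tensors to symmetric tensors; the
symmetrization only serves to give the values the type `⋁ⁿ`.) -/
def gammaSector (e : HilbertBasis ι ℂ Z) (P : Z →L[ℂ] Z) (n : ℕ) : SymPow ι n →L[ℂ] SymPow ι n :=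
  symmetrize n ∘L tensorPowMap (inCoordinates e P) n ∘L incl n

theorem norm_gammaSector_apply_le (e : HilbertBasis ι ℂ Z) {P : Z →L[ℂ] Z} (hP : ‖P‖ ≤ 1) (n : ℕ)
    (ψ : SymPow ι n) : ‖gammaSector e P n ψ‖ ≤ ‖ψ‖ := by
  refine ((symSubmodule ι n).norm_orthogonalProjectionOnto_apply_le _).trans ?_
  refine ((tensorPowMap (inCoordinates e P) n).le_of_opNorm_le (c := 1) ?_ _).trans
    (one_mul _).le
  exact (norm_tensorPowMap_le _ _).trans
    (pow_le_one₀ (norm_nonneg _) ((norm_inCoordinates_le e P).trans hP))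

theorem FockSpace.summable_sq (ψ : FockSpace ι) : Summable fun n => ‖ψ n‖ ^ (2 : ℕ) := by
  have h := (memℓp_gen_iff (p := 2) (by norm_num)).1 (lp.memℓp ψ)
  simpa using h

theorem FockSpace.norm_sq (ψ : FockSpace ι) : ‖ψ‖ ^ (2 : ℕ) = ∑' n, ‖ψ n‖ ^ (2 : ℕ) := by
  have h := lp.norm_rpow_eq_tsum (p := 2) (by norm_num) ψ
  simpa using h

theorem summable_sq_of_contraction (A : ∀ n, SymPow ι n →L[ℂ] SymPow ι n)
    (hA : ∀ n ψ, ‖A n ψ‖ ≤ ‖ψ‖) (ψ : FockSpace ι) : Summable fun n => ‖A n (ψ n)‖ ^ (2 : ℕ) :=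
  Summable.of_nonneg_of_le (fun _ => sq_nonneg _)
    (fun n => pow_le_pow_left₀ (norm_nonneg _) (hA n (ψ n)) 2) (FockSpace.summable_sq ψ)

/-- The linear map on the Fock space acting as the contraction `A n` on `⋁ⁿ`. -/
def blockDiagonalLin (A : ∀ n, SymPow ι n →L[ℂ] SymPow ι n) (hA : ∀ n ψ, ‖A n ψ‖ ≤ ‖ψ‖) :
    FockSpace ι →ₗ[ℂ] FockSpace ι where
  toFun ψ := ⟨fun n => A n (ψ n), (memℓp_gen_iff (p := 2) (by norm_num)).2
    (by simpa using summable_sq_of_contraction A hA ψ)⟩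
  map_add' ψ φ := lp.ext (funext fun n => (A n).map_add (ψ n) (φ n))
  map_smul' a ψ := lp.ext (funext fun n => (A n).map_smul a (ψ n))

theorem norm_blockDiagonalLin_le (A : ∀ n, SymPow ι n →L[ℂ] SymPow ι n)
    (hA : ∀ n ψ, ‖A n ψ‖ ≤ ‖ψ‖) (ψ : FockSpace ι) : ‖blockDiagonalLin A hA ψ‖ ≤ 1 * ‖ψ‖ := by
  refine (pow_le_pow_iff_left₀ (norm_nonneg _) (by positivity) two_ne_zero).1 ?_
  rw [one_mul, FockSpace.norm_sq, FockSpace.norm_sq]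
  exact Summable.tsum_le_tsum (fun n => pow_le_pow_left₀ (norm_nonneg _) (hA n (ψ n)) 2)
    (summable_sq_of_contraction A hA ψ) (FockSpace.summable_sq ψ)

/-- The operator on the Fock space acting as the contraction `A n` on `⋁ⁿ`. -/
def blockDiagonal (A : ∀ n, SymPow ι n →L[ℂ] SymPow ι n) (hA : ∀ n ψ, ‖A n ψ‖ ≤ ‖ψ‖) :
    FockSpace ι →L[ℂ] FockSpace ι :=
  (blockDiagonalLin A hA).mkContinuous 1 (norm_blockDiagonalLin_le A hA)

/-- `Γ(P)` on the Fock space, for a contraction `P`. -/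
def Gamma (e : HilbertBasis ι ℂ Z) (P : Z →L[ℂ] Z) (hP : ‖P‖ ≤ 1) :
    FockSpace ι →L[ℂ] FockSpace ι :=
  blockDiagonal (gammaSector e P) (norm_gammaSector_apply_le e hP)

/-! ### The `σ`-weak topology -/

/-- The `σ`-weak (ultraweak) topology on `ℒ(V, W)`: the coarsest topology for which the maps
`B ↦ ∑ₖ ⟪xₖ, B yₖ⟫` with `∑ ‖xₖ‖² < ∞` and `∑ ‖yₖ‖² < ∞` (that is, the maps `B ↦ Tr[S B]`
with `S` of trace class) are continuous. -/
@[reducible]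
def sigmaWeak (V W : Type*) [NormedAddCommGroup V] [InnerProductSpace ℂ V]
    [NormedAddCommGroup W] [InnerProductSpace ℂ W] : TopologicalSpace (V →L[ℂ] W) :=
  TopologicalSpace.induced
    (fun B (xy : lp (fun _ : ℕ => W) 2 × lp (fun _ : ℕ => V) 2) =>
      ∑' k, inner ℂ (xy.1 k) (B (xy.2 k)))
    Pi.topologicalSpace

/-! ### The conditions on the states -/

open MeasureTheory Filter

/-- `(H0)`: there is `λ > 0` with `Tr[N^k ρ_{ε_n}] ≤ λ^k` for all `k`, uniformly in `n`. -/
def CondH0 (ε : ℕ → ℝ) (ρ : ℕ → FockSpace ι →L[ℂ] FockSpace ι) : Prop :=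
  ∃ c : ℝ, 0 < c ∧ ∀ k n : ℕ, numberMoment (ε n) k (ρ n) ≤ ENNReal.ofReal (c ^ k)

/-- `Tr[ρ_{ε_n} b^{Wick}] → ∫ b dμ` (where `b` is integrable) for the symbol `b`. -/
def WickConverges [MeasurableSpace Z] (e : HilbertBasis ι ℂ Z) (ε : ℕ → ℝ)
    (ρ : ℕ → FockSpace ι →L[ℂ] FockSpace ι) (μ : Measure Z) (b : Symbol ι) : Prop :=
  Integrable (b.eval e) μ ∧
    Tendsto (fun n => wickTrace (ε n) (ρ n) b) atTop (𝓝 (∫ z, b.eval e z ∂μ))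

/-- `μ` is the Wigner measure of the sequence: convergence holds for all symbols with compact
kernels. -/
def IsWignerMeasure [MeasurableSpace Z] (e : HilbertBasis ι ℂ Z) (ε : ℕ → ℝ)
    (ρ : ℕ → FockSpace ι →L[ℂ] FockSpace ι) (μ : Measure Z) : Prop :=
  IsProbabilityMeasure μ ∧ ∀ b : Symbol ι, b.IsCompact → WickConverges e ε ρ μ b

/-- `(P)`: convergence holds for all symbols. -/
def PropertyP [MeasurableSpace Z] (e : HilbertBasis ι ℂ Z) (ε : ℕ → ℝ)
    (ρ : ℕ → FockSpace ι →L[ℂ] FockSpace ι) (μ : Measure Z) : Prop :=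
  ∀ b : Symbol ι, WickConverges e ε ρ μ b

/-- `(T)`: for all `η > 0` there is a finite rank orthogonal projector `P` on `Z` with
`Tr[(1 - Γ(P)) ρ_{ε_n}] < η` for all `n`. -/
def CondT [CompleteSpace Z] (e : HilbertBasis ι ℂ Z)
    (ρ : ℕ → FockSpace ι →L[ℂ] FockSpace ι) : Prop :=
  ∀ η : ℝ, 0 < η → ∃ (P : Z →L[ℂ] Z) (hP : IsStarProjection P),
    FiniteDimensional ℂ P.range ∧
      ∀ n, (trace ((1 - Gamma e P hP.norm_le) ∘L ρ n)).re < η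

/-- `(E)`: for all `p, q` and `η > 0` there is a `σ`-weak neighborhood `W₀` of zero in
`ℒ(⋁ᵖ, ⋁^q)` with `|Tr[ρ_{ε_n} b^{Wick}]| < η` for all `b̃ ∈ W₀` and all `n`. -/
def CondE (ε : ℕ → ℝ) (ρ : ℕ → FockSpace ι →L[ℂ] FockSpace ι) : Prop :=
  ∀ (p q : ℕ) (η : ℝ), 0 < η →
    ∃ W₀ ∈ @nhds _ (sigmaWeak (SymPow ι p) (SymPow ι q)) (0 : SymPow ι p →L[ℂ] SymPow ι q),
      ∀ B ∈ W₀, ∀ n, ‖wickTrace (ε n) (ρ n) (Symbol.monomial B)‖ < η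

end Fock

end

/-!
Write `Φₙ(B) = Tr[ρₙ B^{Wick}]` for an operator `B : ⋁ᵖ → ⋁^q`.  The moment bounds force `ρₙ` to
vanish on the sectors where the number operator exceeds a constant (`apply_single_eq_zero`), and on
the remaining sectors `B^{Wick}` is bounded by `C ‖B‖` with `C` independent of `n`
(`norm_wickSector_le`, `norm_wickCutoff_le`).  Hence `|Φₙ(B)| ≤ C ‖B‖`
(`norm_wickTrace_monomial_le`).  Applied to finite rank projections on `⋁ᵏ` that increase to the
identity, this bound and Fatou's lemma show that `μ` has moments of all orders
(`integrable_norm_pow`).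

Let `Q j` be finite rank projections on `⋁^q` that converge strongly to `1`.  The symbols `Q j B`
are compact, so that `Φₙ(Q j B)` converges to the integral of the symbol `Q j B` as `n → ∞`; these
integrals converge to that of `B` by dominated convergence.  It remains to exchange the limits, for
which `Φₙ(B - Q j B) → 0` as `j → ∞`, uniformly in `n`, suffices (`wickConverges_monomial`).

* Under `(E)` this holds because `Q j B → B` in the `σ`-weak topology (`tendsto_sigmaWeak`).
* Under `(T)` one splits `B - Q j B = (1 - Q j) B P^{⊗ p} + (1 - Q j) B (1 - P^{⊗ p})`.  The first
  operator tends to zero in norm because `B P^{⊗ p}` has finite rank.  The Wick quantization of the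
  second one vanishes on the range of `Γ(P)` (`wickSector_comp_gammaSector`), and the
  Cauchy–Schwarz inequality for Hilbert–Schmidt operators bounds its expectation by a constant times
  `Tr[(1 - Γ(P)) ρₙ] ^ (1/2)` (`norm_trace_comp_le_sqrt`).
-/

noncomputable section

attribute [-instance] CStarModule.toInner

namespace Fock

/-! ### Hilbert–Schmidt norms -/

section HilbertSchmidt

variable {κ E : Type*} [NormedAddCommGroup E] [InnerProductSpace ℂ E]

/-- Parseval's identity in `[0, ∞]`. -/
theorem tsum_enorm_inner_sq (b : HilbertBasis κ ℂ E) (x : E) :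
    ∑' i, ‖inner ℂ (b i) x‖ₑ ^ 2 = ‖x‖ₑ ^ 2 := by
  have h := lp.hasSum_norm (p := 2) (by norm_num) (b.repr x)
  simp only [ENNReal.toReal_ofNat, Real.rpow_ofNat, b.repr_apply_apply,
    LinearIsometryEquiv.norm_map] at h
  have h2 := ENNReal.ofReal_tsum_of_nonneg (fun i => by positivity) h.summable
  rw [h.tsum_eq] at h2
  simp only [ENNReal.ofReal_pow (norm_nonneg _), ofReal_norm] at h2
  exact h2.symm

/-- The square of the Hilbert–Schmidt norm, computed in the Hilbert basis `b`. -/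
def hsSq (b : HilbertBasis κ ℂ E) (T : E →L[ℂ] E) : ℝ≥0∞ := ∑' i, ‖T (b i)‖ₑ ^ 2

theorem hsSq_comp_le (b : HilbertBasis κ ℂ E) (K T : E →L[ℂ] E) :
    hsSq b (K ∘L T) ≤ ‖K‖ₑ ^ 2 * hsSq b T := by
  rw [hsSq, hsSq, ← ENNReal.tsum_mul_left]
  refine ENNReal.tsum_le_tsum fun i => ?_
  rw [← mul_pow]
  gcongr
  exact K.le_opENorm _

theorem summable_of_hsSq_ne_top (b : HilbertBasis κ ℂ E) {T : E →L[ℂ] E} (h : hsSq b T ≠ ∞) :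
    Summable (fun i => ‖T (b i)‖ ^ 2) ∧ ∑' i, ‖T (b i)‖ ^ 2 = (hsSq b T).toReal := by
  have h1 := ENNReal.summable_toReal h
  have h2 : ∀ i, (‖T (b i)‖ₑ ^ 2).toReal = ‖T (b i)‖ ^ 2 := fun i => by simp
  rw [hsSq, ENNReal.tsum_toReal_eq (fun i => by simp)]
  simp only [h2] at h1 ⊢
  exact ⟨h1, trivial⟩

/-- The Cauchy–Schwarz inequality for the Hilbert–Schmidt scalar product. -/
theorem norm_tsum_inner_le (b : HilbertBasis κ ℂ E) {S T : E →L[ℂ] E} (hS : hsSq b S ≠ ∞)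
    (hT : hsSq b T ≠ ∞) :
    Summable (fun i => inner ℂ (S (b i)) (T (b i))) ∧
      ‖∑' i, inner ℂ (S (b i)) (T (b i))‖ ≤ √(hsSq b S).toReal * √(hsSq b T).toReal := by
  obtain ⟨hS1, hS2⟩ := summable_of_hsSq_ne_top b hS
  obtain ⟨hT1, hT2⟩ := summable_of_hsSq_ne_top b hT
  have h := Real.summable_and_inner_le_Lp_mul_Lq_tsum_of_nonneg Real.HolderConjugate.two_two
    (f := fun i => ‖S (b i)‖) (g := fun i => ‖T (b i)‖)
    (fun _ => norm_nonneg _) (fun _ => norm_nonneg _) (by simpa using hS1) (by simpa using hT1)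
  have h3 : Summable fun i => ‖inner ℂ (S (b i)) (T (b i))‖ :=
    Summable.of_nonneg_of_le (fun _ => norm_nonneg _) (fun i => norm_inner_le_norm _ _) h.1
  refine ⟨h3.of_norm, (norm_tsum_le_tsum_norm h3).trans
    ((h3.tsum_le_tsum (fun i => norm_inner_le_norm _ _) h.1).trans ?_)⟩
  rw [← hS2, ← hT2, Real.sqrt_eq_rpow, Real.sqrt_eq_rpow]
  simpa using h.2

variable [CompleteSpace E]

theorem hsSq_adjoint (b : HilbertBasis κ ℂ E) (T : E →L[ℂ] E) :
    hsSq b (ContinuousLinearMap.adjoint T) = hsSq b T := by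
  have h1 : ∀ S : E →L[ℂ] E, hsSq b S = ∑' i, ∑' j, ‖inner ℂ (b j) (S (b i))‖ₑ ^ 2 := fun S => by
    simp only [hsSq, tsum_enorm_inner_sq]
  rw [h1, h1, ENNReal.tsum_comm]
  refine tsum_congr fun i => tsum_congr fun j => ?_
  rw [ContinuousLinearMap.adjoint_inner_right, ← enorm_neg, ← inner_conj_symm, enorm_neg]
  congr 1
  exact RCLike.enorm_conj _

theorem hsSq_comp_le' (b : HilbertBasis κ ℂ E) (K T : E →L[ℂ] E) :
    hsSq b (T ∘L K) ≤ ‖K‖ₑ ^ 2 * hsSq b T := by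
  rw [← hsSq_adjoint, ContinuousLinearMap.adjoint_comp, ← hsSq_adjoint b T]
  refine (hsSq_comp_le _ _ _).trans_eq ?_
  congr 2
  exact LinearIsometryEquiv.enorm_map (ContinuousLinearMap.adjoint (𝕜 := ℂ) (E := E) (F := E)) K

/-- Cyclicity of the trace for a product of two Hilbert–Schmidt operators. -/
theorem tsum_inner_adjoint (b : HilbertBasis κ ℂ E) {S T : E →L[ℂ] E} (hS : hsSq b S ≠ ∞)
    (hT : hsSq b T ≠ ∞) :
    ∑' i, inner ℂ (S (b i)) (T (b i)) = ∑' j, inner ℂ (ContinuousLinearMap.adjoint T (b j))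
      (ContinuousLinearMap.adjoint S (b j)) := by
  have key : ∀ {U : E →L[ℂ] E}, hsSq b U ≠ ∞ →
      Summable fun x : κ × κ => ‖inner ℂ (b x.2) (U (b x.1))‖ ^ 2 := fun {U} hU => by
    have h1 : ∑' x : κ × κ, ‖inner ℂ (b x.2) (U (b x.1))‖ₑ ^ 2 ≠ ∞ := by
      rw [ENNReal.tsum_prod']
      simpa only [hsSq, tsum_enorm_inner_sq] using hU
    simpa using ENNReal.summable_toReal h1
  have hsum : Summable fun x : κ × κ =>
      inner ℂ (S (b x.1)) (b x.2) * inner ℂ (b x.2) (T (b x.1)) := by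
    refine Summable.of_norm_bounded ((key hS).add (key hT)) fun x => ?_
    rw [norm_mul, norm_inner_symm]
    nlinarith [sq_nonneg (‖inner ℂ (b x.2) (S (b x.1))‖ - ‖inner ℂ (b x.2) (T (b x.1))‖),
      sq_nonneg ‖inner ℂ (b x.2) (S (b x.1))‖, sq_nonneg ‖inner ℂ (b x.2) (T (b x.1))‖]
  calc ∑' i, inner ℂ (S (b i)) (T (b i))
      = ∑' i, ∑' j, inner ℂ (S (b i)) (b j) * inner ℂ (b j) (T (b i)) := by
        simp only [b.tsum_inner_mul_inner]
    _ = ∑' j, ∑' i, inner ℂ (S (b i)) (b j) * inner ℂ (b j) (T (b i)) := by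
        exact Summable.tsum_comm (f := fun j i => inner ℂ (S (b i)) (b j) * inner ℂ (b j) (T (b i)))
          ((Equiv.prodComm κ κ).summable_iff.2 hsum)
    _ = _ := by
        refine tsum_congr fun j => ?_
        rw [← b.tsum_inner_mul_inner]
        refine tsum_congr fun i => ?_
        rw [ContinuousLinearMap.adjoint_inner_left, ContinuousLinearMap.adjoint_inner_right,
          mul_comm]

end HilbertSchmidt

/-! ### Traces against a density matrix -/

section Trace

variable {E : Type*} [NormedAddCommGroup E] [InnerProductSpace ℂ E] [CompleteSpace E]

/-- A positive operator of trace one is the square of a self-adjoint operator of Hilbert–Schmidt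
norm one. -/
theorem exists_sqrt_of_posTrace_eq_one {ρ : E →L[ℂ] E} (hρ : ρ.IsPositive)
    (h1 : posTrace ρ = 1) :
    ∃ R : E →L[ℂ] E, ContinuousLinearMap.adjoint R = R ∧ ρ = R ∘L R ∧
      hsSq (someBasis E) R = 1 := by
  have h0 : 0 ≤ ρ := (ContinuousLinearMap.nonneg_iff_isPositive ρ).2 hρ
  have hR : ContinuousLinearMap.adjoint (CFC.sqrt ρ) = CFC.sqrt ρ :=
    (IsSelfAdjoint.of_nonneg (CFC.sqrt_nonneg ρ)).star_eq
  have hRR : ρ = CFC.sqrt ρ ∘L CFC.sqrt ρ := (CFC.sqrt_mul_sqrt_self ρ h0).symm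
  refine ⟨CFC.sqrt ρ, hR, hRR, ?_⟩
  rw [← h1, hsSq, posTrace]
  refine tsum_congr fun i => ?_
  have : inner ℂ (someBasis E i) (ρ (someBasis E i))
      = inner ℂ (CFC.sqrt ρ (someBasis E i)) (CFC.sqrt ρ (someBasis E i)) := by
    conv_lhs => rw [hRR]
    change inner ℂ _ (CFC.sqrt ρ (CFC.sqrt ρ _)) = _
    rw [← ContinuousLinearMap.adjoint_inner_left, hR]
  rw [this, inner_self_eq_norm_sq_to_K, ← ofReal_norm,
    ← ENNReal.ofReal_pow (norm_nonneg _)]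
  norm_cast

theorem inner_apply_of_adjoint_eq_self {R : E →L[ℂ] E}
    (hR : ContinuousLinearMap.adjoint R = R) (x y : E) :
    inner ℂ x (R y) = inner ℂ (R x) y := by
  rw [← ContinuousLinearMap.adjoint_inner_left, hR]

theorem hsSq_comp_le_of_eq_one {R : E →L[ℂ] E} (h : hsSq (someBasis E) R = 1) (K : E →L[ℂ] E) :
    hsSq (someBasis E) (R ∘L K) ≠ ∞ ∧ √(hsSq (someBasis E) (R ∘L K)).toReal ≤ ‖K‖ := by
  have h2 := hsSq_comp_le' (someBasis E) K R
  rw [h, mul_one] at h2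
  refine ⟨ne_top_of_le_ne_top (by simp) h2, Real.sqrt_le_iff.2 ⟨norm_nonneg _, ?_⟩⟩
  have h3 := ENNReal.toReal_mono (by simp) h2
  simpa using h3

theorem trace_comp_eq {R : E →L[ℂ] E} (hR : ContinuousLinearMap.adjoint R = R)
    (K : E →L[ℂ] E) : trace ((R ∘L R) ∘L K)
      = ∑' i, inner ℂ (R (someBasis E i)) ((R ∘L K) (someBasis E i)) := by
  refine tsum_congr fun i => ?_
  rw [← inner_apply_of_adjoint_eq_self hR]
  rfl

theorem trace_comp_add {ρ : E →L[ℂ] E} (hρ : ρ.IsPositive) (h1 : posTrace ρ = 1)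
    (K L : E →L[ℂ] E) : trace (ρ ∘L (K + L)) = trace (ρ ∘L K) + trace (ρ ∘L L) := by
  obtain ⟨R, hR, rfl, hsR⟩ := exists_sqrt_of_posTrace_eq_one hρ h1
  rw [trace_comp_eq hR, trace_comp_eq hR, trace_comp_eq hR]
  have hs : hsSq (someBasis E) R ≠ ∞ := by simp [hsR]
  rw [← Summable.tsum_add (norm_tsum_inner_le _ hs (hsSq_comp_le_of_eq_one hsR K).1).1
    (norm_tsum_inner_le _ hs (hsSq_comp_le_of_eq_one hsR L).1).1]
  refine tsum_congr fun i => ?_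
  rw [← inner_add_right, ContinuousLinearMap.comp_add]
  rfl

theorem norm_trace_comp_le {ρ : E →L[ℂ] E} (hρ : ρ.IsPositive) (h1 : posTrace ρ = 1)
    (K : E →L[ℂ] E) : ‖trace (ρ ∘L K)‖ ≤ ‖K‖ := by
  obtain ⟨R, hR, rfl, hsR⟩ := exists_sqrt_of_posTrace_eq_one hρ h1
  have h := (norm_tsum_inner_le (someBasis E) (S := R) (by simp [hsR])
    (hsSq_comp_le_of_eq_one hsR K).1).2
  rw [trace_comp_eq hR]
  refine h.trans ?_
  simpa [hsR] using (hsSq_comp_le_of_eq_one hsR K).2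

/-- If `K = K G` for an orthogonal projection `G`, then `|Tr[ρ K]|` is at most
`‖K‖ Tr[G ρ] ^ (1/2)`: by cyclicity `Tr[ρ K] = Tr[(K† R)† (G R)]` with `R = ρ ^ (1/2)`, and
`Tr[G ρ]` is the square of the Hilbert–Schmidt norm of `G R`. -/
theorem norm_trace_comp_le_sqrt {ρ : E →L[ℂ] E} (hρ : ρ.IsPositive) (h1 : posTrace ρ = 1)
    {K G : E →L[ℂ] E} (hG : IsStarProjection G) (hK : K ∘L G = K) :
    ‖trace (ρ ∘L K)‖ ≤ ‖K‖ * √(trace (G ∘L ρ)).re := by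
  obtain ⟨R, hR, rfl, hsR⟩ := exists_sqrt_of_posTrace_eq_one hρ h1
  have hGa : ContinuousLinearMap.adjoint G = G := hG.isSelfAdjoint.star_eq
  have hGG : G ∘L G = G := hG.isIdempotentElem
  have hs : hsSq (someBasis E) R ≠ ∞ := by simp [hsR]
  have hGR : hsSq (someBasis E) (G ∘L R) ≠ ∞ := by
    rw [← hsSq_adjoint, ContinuousLinearMap.adjoint_comp, hR]
    exact (hsSq_comp_le_of_eq_one hsR _).1
  have hKR : hsSq (someBasis E) (ContinuousLinearMap.adjoint K ∘L R) ≠ ∞ ∧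
      √(hsSq (someBasis E) (ContinuousLinearMap.adjoint K ∘L R)).toReal ≤ ‖K‖ := by
    rw [← hsSq_adjoint, ContinuousLinearMap.adjoint_comp, hR, ContinuousLinearMap.adjoint_adjoint]
    exact hsSq_comp_le_of_eq_one hsR _
  have htr : (trace (G ∘L (R ∘L R))).re = (hsSq (someBasis E) (G ∘L R)).toReal := by
    have e1 : trace (G ∘L (R ∘L R))
        = ∑' i, inner ℂ ((R ∘L G) (someBasis E i)) (R (someBasis E i)) := by
      refine tsum_congr fun i => ?_
      change inner ℂ _ (G (R (R _))) = inner ℂ (R (G _)) _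
      rw [inner_apply_of_adjoint_eq_self hGa, inner_apply_of_adjoint_eq_self hR]
    rw [e1, tsum_inner_adjoint _ (hsSq_comp_le_of_eq_one hsR G).1 hs,
      ContinuousLinearMap.adjoint_comp, hR, hGa, ← (summable_of_hsSq_ne_top _ hGR).2]
    have e2 : ∀ i, inner ℂ (R (someBasis E i)) ((G ∘L R) (someBasis E i))
        = ((‖(G ∘L R) (someBasis E i)‖ ^ 2 : ℝ) : ℂ) := fun i => by
      conv_lhs => rw [← hGG]
      change inner ℂ _ (G (G (R _))) = _
      rw [inner_apply_of_adjoint_eq_self hGa, inner_self_eq_norm_sq_to_K]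
      norm_cast
    simp only [e2]
    rw [← Complex.ofReal_tsum, Complex.ofReal_re]
  rw [trace_comp_eq hR, tsum_inner_adjoint _ hs (hsSq_comp_le_of_eq_one hsR K).1, hR, htr]
  have e3 : ∀ j, inner ℂ (ContinuousLinearMap.adjoint (R ∘L K) (someBasis E j)) (R (someBasis E j))
      = inner ℂ ((ContinuousLinearMap.adjoint K ∘L R) (someBasis E j))
          ((G ∘L R) (someBasis E j)) := fun j => by
    rw [ContinuousLinearMap.adjoint_comp, hR]
    conv_lhs => rw [← hK, ContinuousLinearMap.adjoint_comp, hGa]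
    change inner ℂ (G _) _ = inner ℂ _ (G _)
    rw [inner_apply_of_adjoint_eq_self hGa]
    rfl
  simp only [e3]
  exact (norm_tsum_inner_le _ hKR.1 hGR).2.trans
    (mul_le_mul_of_nonneg_right hKR.2 (Real.sqrt_nonneg _))

end Trace

variable {ι : Type*}

/-! ### Tensor powers of an operator -/

section TensorProducts

variable {α β γ δ : Type*}

/-- The product vector `u ⊗ v`. -/
def tensorVec (u : L2 α) (v : L2 γ) : L2 (α × γ) :=
  ⟨fun x => u x.1 * v x.2, memL2_of_summable (by
    simpa [mul_pow] using (L2.summable_sq u).mul_of_nonneg (L2.summable_sq v)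
      (fun _ => by positivity) (fun _ => by positivity))⟩

theorem tensorId_tensorVec (A : L2 α →L[ℂ] L2 β) (u : L2 α) (v : L2 γ) :
    tensorId γ A (tensorVec u v) = tensorVec (A u) v := by
  refine lp.ext (funext fun x => ?_)
  have h : slice x.2 (tensorVec u v) = v x.2 • u :=
    lp.ext (funext fun a => mul_comm (u a) (v x.2))
  change A (slice x.2 (tensorVec u v)) x.1 = A u x.1 * v x.2
  rw [h, map_smul, mul_comm]
  rfl

theorem reindex_prodComm_tensorVec (u : L2 α) (v : L2 γ) :
    reindex (Equiv.prodComm α γ) (tensorVec u v) = tensorVec v u :=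
  lp.ext (funext fun x => mul_comm (u x.2) (v x.1))

theorem tensorMap_tensorVec (A : L2 α →L[ℂ] L2 β) (B : L2 γ →L[ℂ] L2 δ) (u : L2 α) (v : L2 γ) :
    tensorMap A B (tensorVec u v) = tensorVec (A u) (B v) := by
  simp only [tensorMap, ContinuousLinearMap.comp_apply, reindex_prodComm_tensorVec,
    tensorId_tensorVec]

end TensorProducts

section PureTensors

theorem reindex_consEquiv_symm_pureTensor {n : ℕ} (x : Fin (n + 1) → L2 ι) :
    reindex (Fin.consEquiv fun _ => ι).symm (pureTensor x)
      = tensorVec (x 0) (pureTensor fun k => x k.succ) :=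
  lp.ext (funext fun _ => Fin.prod_univ_succ _)

theorem reindex_consEquiv_tensorVec {n : ℕ} (x : Fin (n + 1) → L2 ι) :
    reindex (Fin.consEquiv fun _ => ι) (tensorVec (x 0) (pureTensor fun k => x k.succ))
      = pureTensor x :=
  lp.ext (funext fun i => (Fin.prod_univ_succ fun k => x k (i k)).symm)

theorem tensorPowMap_pureTensor (A : L2 ι →L[ℂ] L2 ι) {n : ℕ} (x : Fin n → L2 ι) :
    tensorPowMap A n (pureTensor x) = pureTensor fun k => A (x k) := by
  induction n with
  | zero =>
    change pureTensor x = _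
    congr 1
    exact Subsingleton.elim _ _
  | succ n ih =>
    simp only [tensorPowMap, ContinuousLinearMap.comp_apply, reindex_consEquiv_symm_pureTensor,
      tensorMap_tensorVec, ih]
    exact reindex_consEquiv_tensorVec fun k => A (x k)

theorem reindex_splitEquiv_pureTensor {p n : ℕ} (h : p ≤ n) (x : Fin n → L2 ι) :
    reindex (splitEquiv ι h) (pureTensor x)
      = tensorVec
        (pureTensor fun k : Fin p => x (finCongr (Nat.add_sub_of_le h) (finSumFinEquiv (.inl k))))
        (pureTensor fun k : Fin (n - p) =>
          x (finCongr (Nat.add_sub_of_le h) (finSumFinEquiv (.inr k)))) := by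
  refine lp.ext (funext fun a => ?_)
  change ∏ k, x k ((splitEquiv ι h).symm a k) = (∏ k, _) * ∏ k, _
  have hs : ∀ s, (splitEquiv ι h).symm a (finCongr (Nat.add_sub_of_le h) (finSumFinEquiv s))
      = Sum.elim a.1 a.2 s := fun s => by
    change Sum.elim a.1 a.2 (finSumFinEquiv.symm ((finCongr _) (finCongr _ (finSumFinEquiv s)))) = _
    congr 1
    exact finSumFinEquiv.symm_apply_apply s
  rw [← (finSumFinEquiv.trans (finCongr (Nat.add_sub_of_le h))).prod_comp, Fintype.prod_sum_type]
  congr 1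
  · refine Finset.prod_congr rfl fun k _ => ?_
    rw [Equiv.trans_apply, hs]
    rfl
  · refine Finset.prod_congr rfl fun k _ => ?_
    rw [Equiv.trans_apply, hs]
    rfl

/-- Continuous linear maps that agree on pure tensors are equal. -/
theorem ext_pureTensor {F : Type*} [NormedAddCommGroup F] [NormedSpace ℂ F] {n : ℕ}
    {S T : TensorPow ι n →L[ℂ] F} (h : ∀ x, S (pureTensor x) = T (pureTensor x)) : S = T :=
  ContinuousLinearMap.ext_on (dense_span_pureTensor n) (by rintro _ ⟨x, rfl⟩; exact h x)

theorem inner_tensorPowMap {A : L2 ι →L[ℂ] L2 ι} (hA : IsStarProjection A) {n : ℕ}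
    (φ ψ : TensorPow ι n) :
    inner ℂ (tensorPowMap A n φ) ψ = inner ℂ φ (tensorPowMap A n ψ) := by
  have hadj : ContinuousLinearMap.adjoint A = A := hA.isSelfAdjoint.star_eq
  have h1 : ∀ y : Fin n → L2 ι, innerSL ℂ (tensorPowMap A n (pureTensor y))
      = innerSL ℂ (pureTensor y) ∘L tensorPowMap A n := fun y => ext_pureTensor fun x => by
    simp only [ContinuousLinearMap.comp_apply, innerSL_apply_apply, tensorPowMap_pureTensor,
      inner_pureTensor]
    refine Finset.prod_congr rfl fun k _ => ?_
    rw [← ContinuousLinearMap.adjoint_inner_right, hadj]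
  have h2 : innerSL ℂ (tensorPowMap A n ψ) = innerSL ℂ ψ ∘L tensorPowMap A n :=
    ext_pureTensor fun y => by
      have h := congrArg (starRingEnd ℂ) (congrArg (fun f => f ψ) (h1 y))
      simpa using h.symm
  have h := congrArg (starRingEnd ℂ) (congrArg (fun f => f φ) h2)
  simpa using h.symm

theorem tensorPowMap_comp_self {A : L2 ι →L[ℂ] L2 ι} (hA : IsStarProjection A) (n : ℕ) :
    tensorPowMap A n ∘L tensorPowMap A n = tensorPowMap A n :=
  ext_pureTensor fun x => by
    simp only [ContinuousLinearMap.comp_apply, tensorPowMap_pureTensor]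
    congr 1
    funext k
    exact congrArg (fun f => f (x k)) hA.isIdempotentElem.eq

theorem tensorPowMap_mem_symSubmodule (A : L2 ι →L[ℂ] L2 ι) {n : ℕ} {ψ : TensorPow ι n}
    (hψ : ψ ∈ symSubmodule ι n) : tensorPowMap A n ψ ∈ symSubmodule ι n := by
  intro σ i
  have h1 : tensorPowMap A n ∘L reindex (Equiv.arrowCongr σ (Equiv.refl ι))
      = reindex (Equiv.arrowCongr σ (Equiv.refl ι)) ∘L tensorPowMap A n :=
    ext_pureTensor fun x => by
      have h2 : ∀ y : Fin n → L2 ι, reindex (Equiv.arrowCongr σ (Equiv.refl ι)) (pureTensor y)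
          = pureTensor (y ∘ σ.symm) := fun y => lp.ext (funext fun j => by
        change ∏ k, y k (j (σ k)) = ∏ k, y (σ.symm k) (j k)
        rw [← Equiv.prod_comp σ fun k => y (σ.symm k) (j k)]
        simp)
      simp only [ContinuousLinearMap.comp_apply, tensorPowMap_pureTensor, h2]
      rfl
  have h3 : reindex (Equiv.arrowCongr σ (Equiv.refl ι)) ψ = ψ :=
    lp.ext (funext fun j => hψ σ j)
  have h4 := congrArg (fun f => f ψ) h1
  simp only [ContinuousLinearMap.comp_apply, h3] at h4
  exact (congrArg (fun φ : TensorPow ι n => φ i) h4).symm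

/-- The pure tensor as a multilinear map. -/
def pureTensorMultilinear (ι : Type*) (n : ℕ) :
    MultilinearMap ℂ (fun _ : Fin n => L2 ι) (TensorPow ι n) where
  toFun := pureTensor
  map_update_add' x j a b := lp.ext (funext fun i => by
    have h := ((MultilinearMap.mkPiAlgebra ℂ (Fin n) ℂ).compLinearMap fun k =>
      (lp.evalCLM ℂ (fun _ : ι => ℂ) 2 (i k)).toLinearMap).map_update_add x j a b
    simp only [MultilinearMap.compLinearMap_apply, MultilinearMap.mkPiAlgebra_apply] at h
    exact h)
  map_update_smul' x j c a := lp.ext (funext fun i => by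
    have h := ((MultilinearMap.mkPiAlgebra ℂ (Fin n) ℂ).compLinearMap fun k =>
      (lp.evalCLM ℂ (fun _ : ι => ℂ) 2 (i k)).toLinearMap).map_update_smul x j c a
    simp only [MultilinearMap.compLinearMap_apply, MultilinearMap.mkPiAlgebra_apply] at h
    exact h)

theorem isCompactOperator_of_forall_mem {V W : Type*} [NormedAddCommGroup V] [NormedSpace ℂ V]
    [NormedAddCommGroup W] [NormedSpace ℂ W] (T : V →L[ℂ] W) (F : Submodule ℂ W)
    [FiniteDimensional ℂ F] (h : ∀ x, T x ∈ F) : IsCompactOperator T := by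
  have : ProperSpace F := FiniteDimensional.proper ℂ F
  have h1 : IsCompactOperator (id : F → F) := isCompactOperator_id
  exact (h1.comp_clm (T.codRestrict F h)).clm_comp F.subtypeL

theorem isCompactOperator_tensorPowMap (A : L2 ι →L[ℂ] L2 ι) [FiniteDimensional ℂ A.range]
    (n : ℕ) : IsCompactOperator (tensorPowMap A n) := by
  let f := PiTensorProduct.lift
    ((pureTensorMultilinear ι n).compLinearMap fun _ => A.range.subtype)
  have : FiniteDimensional ℂ (LinearMap.range f) := inferInstance
  refine isCompactOperator_of_forall_mem _ (LinearMap.range f) fun ψ => ?_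
  have hcl : IsClosed (((LinearMap.range f).comap (tensorPowMap A n).toLinearMap :
      Submodule ℂ (TensorPow ι n)) : Set (TensorPow ι n)) :=
    (Submodule.closed_of_finiteDimensional (LinearMap.range f)).preimage
      (tensorPowMap A n).continuous
  have hle : Submodule.span ℂ (Set.range (pureTensor (ι := ι) (n := n)))
      ≤ (LinearMap.range f).comap (tensorPowMap A n).toLinearMap := by
    rw [Submodule.span_le]
    rintro _ ⟨x, rfl⟩
    refine ⟨PiTensorProduct.tprod ℂ fun k => ⟨A (x k), x k, rfl⟩, ?_⟩
    rw [PiTensorProduct.lift.tprod]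
    exact (tensorPowMap_pureTensor A x).symm
  exact closure_minimal hle hcl (dense_span_pureTensor n ψ)

end PureTensors

/-! ### The operators `P^{⊗ n}` and `Γ(P)` for an orthogonal projection `P` -/

section SecondQuantization

variable {Z : Type*} [NormedAddCommGroup Z] [InnerProductSpace ℂ Z]

theorem symmetrize_incl {n : ℕ} (ψ : SymPow ι n) : symmetrize n (incl n ψ) = ψ :=
  Submodule.orthogonalProjectionOnto_mem_subspace_eq_self (K := symSubmodule ι n) ψ

theorem inner_incl_right {n : ℕ} (φ : TensorPow ι n) (ψ : SymPow ι n) :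
    inner ℂ φ (incl n ψ) = inner ℂ (symmetrize n φ) ψ :=
  (Submodule.inner_orthogonalProjectionOnto_eq_of_mem_right (K := symSubmodule ι n) ψ φ).symm

theorem inner_incl_left {n : ℕ} (φ : TensorPow ι n) (ψ : SymPow ι n) :
    inner ℂ (incl n ψ) φ = inner ℂ ψ (symmetrize n φ) :=
  (Submodule.inner_orthogonalProjectionOnto_eq_of_mem_left (K := symSubmodule ι n) ψ φ).symm

theorem incl_gammaSector (e : HilbertBasis ι ℂ Z) (P : Z →L[ℂ] Z) {n : ℕ} (ψ : SymPow ι n) :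
    incl n (gammaSector e P n ψ) = tensorPowMap (inCoordinates e P) n (incl n ψ) :=
  congrArg Subtype.val (Submodule.orthogonalProjectionOnto_mem_subspace_eq_self
    (K := symSubmodule ι n) ⟨_, tensorPowMap_mem_symSubmodule (inCoordinates e P) ψ.2⟩)

theorem isCompactOperator_gammaSector (e : HilbertBasis ι ℂ Z) (P : Z →L[ℂ] Z)
    [FiniteDimensional ℂ P.range] (n : ℕ) : IsCompactOperator (gammaSector e P n) := by
  have : FiniteDimensional ℂ (inCoordinates e P).range := by
    have h : (inCoordinates e P).range
        ≤ P.range.map (e.repr.toContinuousLinearEquiv : Z →L[ℂ] L2 ι).toLinearMap := by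
      rintro _ ⟨x, rfl⟩
      exact ⟨_, ⟨e.repr.symm x, rfl⟩, rfl⟩
    exact Submodule.finiteDimensional_of_le h
  exact ((isCompactOperator_tensorPowMap (inCoordinates e P) n).comp_clm (incl n)).clm_comp
    (symmetrize n)

variable [CompleteSpace Z]

theorem isStarProjection_inCoordinates (e : HilbertBasis ι ℂ Z) {P : Z →L[ℂ] Z}
    (hP : IsStarProjection P) : IsStarProjection (inCoordinates e P) := by
  have hadj : ContinuousLinearMap.adjoint P = P := hP.isSelfAdjoint.star_eq
  refine ⟨ContinuousLinearMap.ext fun x => ?_, ?_⟩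
  · change e.repr (P (e.repr.symm (e.repr (P (e.repr.symm x))))) = e.repr (P (e.repr.symm x))
    rw [e.repr.symm_apply_apply]
    exact congrArg (fun f => e.repr (f (e.repr.symm x))) hP.isIdempotentElem.eq
  · refine ContinuousLinearMap.isSelfAdjoint_iff_isSymmetric.2 fun x y => ?_
    change inner ℂ (e.repr (P (e.repr.symm x))) y = inner ℂ x (e.repr (P (e.repr.symm y)))
    rw [← e.repr.symm.inner_map_map, ← e.repr.symm.inner_map_map x, e.repr.symm_apply_apply,
      e.repr.symm_apply_apply, ← ContinuousLinearMap.adjoint_inner_right, hadj]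

theorem gammaSector_symmetrize (e : HilbertBasis ι ℂ Z) {P : Z →L[ℂ] Z}
    (hP : IsStarProjection P) {n : ℕ} (φ : TensorPow ι n) :
    gammaSector e P n (symmetrize n φ)
      = symmetrize n (tensorPowMap (inCoordinates e P) n φ) := by
  refine ext_inner_right ℂ fun ψ => ?_
  have hA := isStarProjection_inCoordinates e hP
  rw [← inner_incl_right, inner_tensorPowMap hA, ← incl_gammaSector, inner_incl_right]
  change inner ℂ (symmetrize n (tensorPowMap _ n (incl n (symmetrize n φ)))) ψ = _
  rw [← inner_incl_right, inner_tensorPowMap hA, ← incl_gammaSector, inner_incl_left,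
    symmetrize_incl]

theorem inner_gammaSector (e : HilbertBasis ι ℂ Z) {P : Z →L[ℂ] Z}
    (hP : IsStarProjection P) {n : ℕ} (φ ψ : SymPow ι n) :
    inner ℂ (gammaSector e P n φ) ψ = inner ℂ φ (gammaSector e P n ψ) := by
  change inner ℂ (incl n (gammaSector e P n φ)) (incl n ψ)
    = inner ℂ (incl n φ) (incl n (gammaSector e P n ψ))
  rw [incl_gammaSector, incl_gammaSector, inner_tensorPowMap (isStarProjection_inCoordinates e hP)]

theorem gammaSector_gammaSector (e : HilbertBasis ι ℂ Z) {P : Z →L[ℂ] Z}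
    (hP : IsStarProjection P) {n : ℕ} (ψ : SymPow ι n) :
    gammaSector e P n (gammaSector e P n ψ) = gammaSector e P n ψ := by
  change symmetrize n (tensorPowMap _ n (incl n (gammaSector e P n ψ))) = _
  rw [incl_gammaSector]
  exact congrArg (fun f => symmetrize n (f (incl n ψ)))
    (tensorPowMap_comp_self (isStarProjection_inCoordinates e hP) n)

theorem isStarProjection_Gamma (e : HilbertBasis ι ℂ Z) {P : Z →L[ℂ] Z}
    (hP : IsStarProjection P) : IsStarProjection (Gamma e P hP.norm_le) := by
  refine ⟨ContinuousLinearMap.ext fun ψ => lp.ext (funext fun n => ?_), ?_⟩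
  · exact gammaSector_gammaSector e hP (ψ n)
  · refine ContinuousLinearMap.isSelfAdjoint_iff_isSymmetric.2 fun φ ψ => ?_
    refine (lp.inner_eq_tsum _ _).trans ((tsum_congr fun n => ?_).trans
      (lp.inner_eq_tsum _ _).symm)
    exact inner_gammaSector e hP (φ n) (ψ n)

/-- On `Γ(P)`-invariant vectors, the first `p` factors are invariant under `P^{⊗ p}`, and a Wick
monomial whose operator vanishes on the range of `P^{⊗ p}` is zero. -/
theorem wickSector_comp_gammaSector (e : HilbertBasis ι ℂ Z) {P : Z →L[ℂ] Z}
    (hP : IsStarProjection P) (ε : ℝ) {p q : ℕ} (B : SymPow ι p →L[ℂ] SymPow ι q) (n : ℕ)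
    (ψ : SymPow ι n) :
    wickSector ε (B ∘L (1 - gammaSector e P p)) n (gammaSector e P n ψ) = 0 := by
  unfold wickSector
  split_ifs with h
  · set A := inCoordinates e P
    have hA : IsStarProjection A := isStarProjection_inCoordinates e hP
    have h1 : tensorId (Fin (n - p) → ι)
        (incl q ∘L (B ∘L (1 - gammaSector e P p)) ∘L symmetrize p) ∘L
        reindex (splitEquiv ι h) ∘L tensorPowMap A n = 0 := ext_pureTensor fun x => by
      simp only [ContinuousLinearMap.comp_apply, tensorPowMap_pureTensor]
      rw [reindex_splitEquiv_pureTensor, tensorId_tensorVec]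
      have h2 : ∀ φ : TensorPow ι p,
          (1 - gammaSector e P p) (symmetrize p (tensorPowMap A p φ)) = 0 := fun φ => by
        change symmetrize p (tensorPowMap A p φ)
          - gammaSector e P p (symmetrize p (tensorPowMap A p φ)) = 0
        rw [gammaSector_symmetrize e hP, sub_eq_zero]
        exact congrArg (fun f => symmetrize p (f φ)) (tensorPowMap_comp_self hA p).symm
      rw [← tensorPowMap_pureTensor]
      simp only [ContinuousLinearMap.comp_apply, h2, map_zero]
      exact lp.ext (funext fun x => zero_mul _)
    have h2 := congrArg (fun f => f (incl n ψ)) h1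
    simp only [ContinuousLinearMap.comp_apply] at h2
    simp only [smul_apply, ContinuousLinearMap.comp_apply]
    rw [incl_gammaSector]
    rw [h2]
    simp
  · simp

end SecondQuantization

/-! ### Bounded extensions of Wick operators -/

section Extension

theorem toFock_lof (n : ℕ) (x : SymPow ι n) :
    toFock (DirectSum.lof ℂ ℕ (fun m => SymPow ι m) n x) = lp.single 2 n x :=
  DirectSum.toModule_lof ℂ n x

/-- A continuous linear map on the Fock space that extends `A` is the bounded extension of `A`. -/
theorem boundedExtension_eq {A : FiniteFock ι →ₗ[ℂ] FockSpace ι}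
    {T : FockSpace ι →L[ℂ] FockSpace ι} (h : ∀ ψ, T (toFock ψ) = A ψ) :
    boundedExtension A = T := by
  have hex : ∃ T : FockSpace ι →L[ℂ] FockSpace ι, ∀ ψ, T (toFock ψ) = A ψ := ⟨T, h⟩
  have h1 : boundedExtension A = hex.choose := dif_pos hex
  rw [h1]
  refine lp.ext_continuousLinearMap (by norm_num) fun n => ContinuousLinearMap.ext fun x => ?_
  have h2 := (hex.choose_spec (DirectSum.lof ℂ ℕ (fun m => SymPow ι m) n x)).trans (h _).symm
  rw [toFock_lof] at h2
  exact h2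

/-- The bounded operator `K` may replace `b^{Wick}` to the right of `ρ`. -/
def IsWickExtension (ε : ℝ) (ρ : FockSpace ι →L[ℂ] FockSpace ι) (b : Symbol ι)
    (K : FockSpace ι →L[ℂ] FockSpace ι) : Prop :=
  ∀ ψ, ρ (K (toFock ψ)) = ρ (toFock (wick ε b ψ))

theorem IsWickExtension.wickTrace_eq {ε : ℝ} {ρ : FockSpace ι →L[ℂ] FockSpace ι} {b : Symbol ι}
    {K : FockSpace ι →L[ℂ] FockSpace ι} (h : IsWickExtension ε ρ b K) :
    wickTrace ε ρ b = trace (ρ ∘L K) := by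
  exact congrArg trace (boundedExtension_eq (A := ρ.toLinearMap ∘ₗ toFock ∘ₗ wick ε b)
    (T := ρ ∘L K) h)

theorem IsWickExtension.add {ε : ℝ} {ρ : FockSpace ι →L[ℂ] FockSpace ι} {b b' : Symbol ι}
    {K K' : FockSpace ι →L[ℂ] FockSpace ι} (h : IsWickExtension ε ρ b K)
    (h' : IsWickExtension ε ρ b' K') : IsWickExtension ε ρ (b + b') (K + K') := fun ψ => by
  have := congrArg₂ (· + ·) (h ψ) (h' ψ)
  simpa [wick] using this

end Extension

/-! ### Uniform bounds for the expectations of Wick monomials -/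

section Cutoff

/-- The sectors `n ≥ p` that a Wick monomial of type `(p, q)` maps to a sector where the number
operator is at most `c`. -/
def cutoffSectors (ε c : ℝ) (p q : ℕ) : Finset ℕ :=
  (Finset.range (p + ⌊c / ε⌋₊ + 1)).filter fun n => p ≤ n ∧ ε * (n - p + q : ℕ) ≤ c

theorem mem_cutoffSectors {ε c : ℝ} (hε : 0 < ε) {p q n : ℕ} :
    n ∈ cutoffSectors ε c p q ↔ p ≤ n ∧ ε * (n - p + q : ℕ) ≤ c := by
  refine ⟨fun h => (Finset.mem_filter.1 h).2, fun h => Finset.mem_filter.2 ⟨?_, h⟩⟩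
  have h1 : ((n - p : ℕ) : ℝ) ≤ c / ε := by
    rw [le_div_iff₀ hε, mul_comm]
    refine le_trans ?_ h.2
    gcongr
    omega
  have h2 := Nat.le_floor h1
  rw [Finset.mem_range]
  omega

/-- The Wick monomial restricted to the sectors `cutoffSectors ε c p q`, a bounded operator on the
Fock space. -/
def wickCutoff (ε c : ℝ) {p q : ℕ} (B : SymPow ι p →L[ℂ] SymPow ι q) :
    FockSpace ι →L[ℂ] FockSpace ι :=
  ∑ n ∈ cutoffSectors ε c p q, lp.singleContinuousLinearMap ℂ (fun m => SymPow ι m) 2 (n - p + q) ∘L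
    wickSector ε B n ∘L lp.evalCLM ℂ (fun m => SymPow ι m) 2 n

theorem wickCutoff_apply (ε c : ℝ) {p q : ℕ} (B : SymPow ι p →L[ℂ] SymPow ι q)
    (ψ : FockSpace ι) : wickCutoff ε c B ψ =
      ∑ n ∈ cutoffSectors ε c p q, lp.single 2 (n - p + q) (wickSector ε B n (ψ n)) := by
  rw [wickCutoff, sum_apply]
  rfl

theorem sum_sq_le_norm_sq {s : Finset ℕ} {f : ℕ → ℕ} (hf : Set.InjOn f s) (ψ : FockSpace ι) :
    ∑ n ∈ s, ‖ψ (f n)‖ ^ 2 ≤ ‖ψ‖ ^ 2 := by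
  rw [FockSpace.norm_sq, ← Finset.sum_image (f := fun n => ‖ψ n‖ ^ 2) hf]
  exact (FockSpace.summable_sq ψ).sum_le_tsum _ fun _ _ => by positivity

/-- Since `n ↦ n - p + q` is injective on `n ≥ p`, the cut-off operator is bounded by the largest
norm of its blocks. -/
theorem norm_wickCutoff_le {ε c C : ℝ} (hε : 0 < ε) (hC : 0 ≤ C) {p q : ℕ}
    (B : SymPow ι p →L[ℂ] SymPow ι q)
    (h : ∀ n ∈ cutoffSectors ε c p q, ‖wickSector ε B n‖ ≤ C) : ‖wickCutoff ε c B‖ ≤ C := by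
  refine ContinuousLinearMap.opNorm_le_bound _ hC fun ψ => ?_
  set φ := wickCutoff ε c B ψ with hφ
  have hinj : Set.InjOn (fun n => n - p + q) (cutoffSectors ε c p q) := fun m hm n hn hmn => by
    have h1 := ((mem_cutoffSectors hε).1 hm).1
    have h2 := ((mem_cutoffSectors hε).1 hn).1
    simp only at hmn
    omega
  have hin : ∀ χ : FockSpace ι, inner ℂ χ φ
      = ∑ n ∈ cutoffSectors ε c p q, inner ℂ (χ (n - p + q)) (wickSector ε B n (ψ n)) := fun χ => by
    rw [hφ, wickCutoff_apply, inner_sum]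
    simp only [lp.inner_single_right]
  have h1 : ‖φ‖ ^ 2 ≤ C * ‖ψ‖ * ‖φ‖ := by
    calc ‖φ‖ ^ 2 = ‖inner ℂ φ φ‖ := by rw [inner_self_eq_norm_sq_to_K]; simp
      _ = ‖∑ n ∈ cutoffSectors ε c p q, inner ℂ (φ (n - p + q)) (wickSector ε B n (ψ n))‖ := by
        rw [hin]
      _ ≤ ∑ n ∈ cutoffSectors ε c p q, ‖φ (n - p + q)‖ * (C * ‖ψ n‖) := by
        refine (norm_sum_le _ _).trans (Finset.sum_le_sum fun n hn => ?_)
        refine (norm_inner_le_norm _ _).trans ?_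
        gcongr
        exact (wickSector ε B n).le_of_opNorm_le (h n hn) _
      _ = C * ∑ n ∈ cutoffSectors ε c p q, ‖φ (n - p + q)‖ * ‖ψ n‖ := by
        rw [Finset.mul_sum]
        exact Finset.sum_congr rfl fun n _ => by ring
      _ ≤ C * (√(∑ n ∈ cutoffSectors ε c p q, ‖φ (n - p + q)‖ ^ 2)
          * √(∑ n ∈ cutoffSectors ε c p q, ‖ψ n‖ ^ 2)) := by
        gcongr
        exact Real.sum_mul_le_sqrt_mul_sqrt _ _ _
      _ ≤ C * (‖φ‖ * ‖ψ‖) := by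
        gcongr
        · exact Real.sqrt_le_iff.2 ⟨norm_nonneg _, sum_sq_le_norm_sq hinj φ⟩
        · exact Real.sqrt_le_iff.2 ⟨norm_nonneg _,
            sum_sq_le_norm_sq (f := id) (Set.injOn_id _) ψ⟩
      _ = C * ‖ψ‖ * ‖φ‖ := by ring
  by_contra! hlt
  nlinarith [norm_nonneg φ, mul_nonneg hC (norm_nonneg ψ)]

/-- On the sectors of the cut-off, the coefficient of the Wick monomial is at most
`(ε n) ^ (p / 2) * (ε (n - p + q)) ^ (q / 2)`, which is bounded independently of `ε`. -/
theorem norm_wickSector_le {ε c M : ℝ} (hε : 0 < ε) (hM : ε ≤ M) {p q : ℕ}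
    (B : SymPow ι p →L[ℂ] SymPow ι q) {n : ℕ} (hn : n ∈ cutoffSectors ε c p q) :
    ‖wickSector ε B n‖ ≤ √((c + M * p) ^ p * c ^ q) * ‖B‖ := by
  obtain ⟨hp, hc⟩ := (mem_cutoffSectors hε).1 hn
  have hM0 : 0 ≤ M := hε.le.trans hM
  have hc0 : 0 ≤ c := le_trans (by positivity) hc
  have hr : ∀ {α β : Type _} (e : α ≃ β) (φ : L2 α), ‖reindex e φ‖ ≤ ‖φ‖ := fun e φ => by
    simpa using (reindex e).le_of_opNorm_le (norm_reindex_le e) φ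
  have hsym : ∀ {m : ℕ} (φ : TensorPow ι m), ‖symmetrize m φ‖ ≤ ‖φ‖ := fun {m} φ =>
    (symSubmodule ι m).norm_orthogonalProjectionOnto_apply_le φ
  have hB : ∀ φ : TensorPow ι p, ‖(incl q ∘L B ∘L symmetrize p) φ‖ ≤ ‖B‖ * ‖φ‖ := fun φ =>
    (B.le_opNorm (symmetrize p φ)).trans (by gcongr; exact hsym φ)
  have hcoef : √((n.factorial : ℝ) * ((n - p + q).factorial : ℝ)) / ((n - p).factorial : ℝ)
        * ε ^ (((p : ℝ) + (q : ℝ)) / 2) ≤ √((c + M * p) ^ p * c ^ q) := by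
    refine Real.le_sqrt_of_sq_le ?_
    have e1 : (n.factorial : ℝ) = (n - p).factorial * (n.descFactorial p : ℝ) := by
      exact_mod_cast (Nat.factorial_mul_descFactorial hp).symm
    have e2 : ((n - p + q).factorial : ℝ)
        = (n - p).factorial * ((n - p + q).descFactorial q : ℝ) := by
      have := Nat.factorial_mul_descFactorial (Nat.le_add_left q (n - p))
      rw [Nat.add_sub_cancel] at this
      exact_mod_cast this.symm
    have e3 : (ε ^ (((p : ℝ) + (q : ℝ)) / 2)) ^ 2 = ε ^ p * ε ^ q := by
      rw [← Real.rpow_natCast, ← Real.rpow_mul hε.le, ← pow_add, ← Real.rpow_natCast]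
      congr 1
      push_cast
      ring
    have hf : ((n - p).factorial : ℝ) ≠ 0 := by positivity
    calc _ = (n.descFactorial p : ℝ) * ((n - p + q).descFactorial q : ℝ) * (ε ^ p * ε ^ q) := by
          rw [mul_pow, e3, div_pow, Real.sq_sqrt (by positivity), e1, e2]
          field_simp
      _ ≤ (n : ℝ) ^ p * ((n - p + q : ℕ) : ℝ) ^ q * (ε ^ p * ε ^ q) := by
          gcongr
          · exact_mod_cast Nat.descFactorial_le_pow n p
          · exact_mod_cast Nat.descFactorial_le_pow (n - p + q) q
      _ = (ε * n) ^ p * (ε * (n - p + q : ℕ)) ^ q := by rw [mul_pow, mul_pow]; ring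
      _ ≤ (c + M * p) ^ p * c ^ q := by
          have h1 : ε * n ≤ c + M * p := by
            have h2 : (n : ℝ) ≤ (n - p + q : ℕ) + p := by
              norm_cast
              omega
            nlinarith [mul_le_mul_of_nonneg_right hM (Nat.cast_nonneg (α := ℝ) p),
              mul_le_mul_of_nonneg_left h2 hε.le]
          gcongr
  refine ContinuousLinearMap.opNorm_le_bound _ (by positivity) fun ψ => ?_
  rw [wickSector, dif_pos hp, smul_apply, norm_smul, Complex.norm_real,
    Real.norm_of_nonneg (by positivity), mul_assoc (√((c + M * p) ^ p * c ^ q))]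
  refine mul_le_mul hcoef ?_ (norm_nonneg _) (Real.sqrt_nonneg _)
  simp only [ContinuousLinearMap.comp_apply]
  refine (hsym _).trans ((hr _ _).trans (((tensorId _ _).le_of_opNorm_le
    ((norm_tensorId_le _).trans (ContinuousLinearMap.opNorm_le_bound _ (norm_nonneg B) hB)) _).trans
    ?_))
  gcongr
  exact hr _ _

/-- The moment bounds force a density matrix to vanish on the sectors where the number operator
exceeds `c`: a nonzero trace there would make the `k`-th moment grow faster than `c ^ k`. -/
theorem apply_single_eq_zero {ε c : ℝ} (hc : 0 < c) {ρ : FockSpace ι →L[ℂ] FockSpace ι}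
    (hρ : IsDensityMatrix ρ) (hmom : ∀ k, numberMoment ε k ρ ≤ ENNReal.ofReal (c ^ k)) {n : ℕ}
    (hn : c < ε * n) (x : SymPow ι n) : ρ (lp.single 2 n x) = 0 := by
  have hblock : posTrace (block ρ n) = 0 := by
    by_contra ht
    have h1 : ∀ k, ENNReal.ofReal ((ε * n / c) ^ k) * posTrace (block ρ n) ≤ 1 := fun k => by
      have h2 := (ENNReal.le_tsum (f := fun n : ℕ =>
        ENNReal.ofReal ((ε * n) ^ k) * posTrace (block ρ n)) n).trans (hmom k)
      have h3 : ENNReal.ofReal (c ^ k) ≠ 0 := by simpa using pow_pos hc k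
      rw [div_pow, ENNReal.ofReal_div_of_pos (by positivity), ENNReal.div_eq_inv_mul, mul_assoc]
      exact (ENNReal.inv_mul_le_iff h3 ENNReal.ofReal_ne_top).2 (by simpa using h2)
    have h4 : Filter.Tendsto (fun k : ℕ => ENNReal.ofReal ((ε * n / c) ^ k) * posTrace (block ρ n))
        Filter.atTop (𝓝 (∞ * posTrace (block ρ n))) :=
      ENNReal.Tendsto.mul_const (ENNReal.tendsto_ofReal_nhds_top.2
        (tendsto_pow_atTop_atTop_of_one_lt ((one_lt_div hc).2 hn))) (Or.inl ENNReal.top_ne_zero)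
    have h5 := le_of_tendsto' h4 h1
    rw [ENNReal.top_mul ht] at h5
    simp at h5
  obtain ⟨R, hR, rfl, -⟩ := exists_sqrt_of_posTrace_eq_one hρ.1 hρ.2
  set J := lp.singleContinuousLinearMap ℂ (fun m => SymPow ι m) 2 n
  have h1 : R ∘L J = 0 := by
    refine ContinuousLinearMap.ext_on (Submodule.dense_iff_topologicalClosure_eq_top.2
      (someBasis (SymPow ι n)).dense_span) ?_
    rintro _ ⟨i, rfl⟩
    have h2 := ENNReal.tsum_eq_zero.1 hblock i
    have h3 : inner ℂ (someBasis (SymPow ι n) i) (block (R ∘L R) n (someBasis (SymPow ι n) i))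
        = inner ℂ (R (J (someBasis (SymPow ι n) i))) (R (J (someBasis (SymPow ι n) i))) := by
      rw [← inner_apply_of_adjoint_eq_self hR]
      exact (lp.inner_single_left n (someBasis (SymPow ι n) i) _).symm
    rw [h3, inner_self_eq_norm_sq_to_K, ENNReal.ofReal_eq_zero] at h2
    have h4 : ‖R (J (someBasis (SymPow ι n) i))‖ ^ 2 ≤ 0 := by exact_mod_cast h2
    simpa using h4
  change R (R (J x)) = 0
  rw [show R (J x) = 0 from congrArg (fun f => f x) h1, map_zero]

theorem wick_monomial_lof (ε : ℝ) {p q : ℕ} (B : SymPow ι p →L[ℂ] SymPow ι q) (n : ℕ)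
    (x : SymPow ι n) :
    wick ε (Symbol.monomial B) (DirectSum.lof ℂ ℕ (fun m => SymPow ι m) n x)
      = DirectSum.lof ℂ ℕ (fun m => SymPow ι m) (n - p + q) (wickSector ε B n x) := by
  have h : wick ε (Symbol.monomial B) = wickMonomial ε p q B :=
    DirectSum.toModule_lof ℂ (M := fun pq : ℕ × ℕ => SymPow ι pq.1 →L[ℂ] SymPow ι pq.2)
      (φ := fun pq : ℕ × ℕ => wickMonomial (ι := ι) ε pq.1 pq.2) (p, q) B
  rw [h]
  exact DirectSum.toModule_lof ℂ (M := fun m => SymPow ι m)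
    (φ := fun n => DirectSum.lof ℂ ℕ (fun m => SymPow ι m) (n - p + q) ∘ₗ
      (wickSector ε B n).toLinearMap) n x

theorem isWickExtension_wickCutoff {ε c : ℝ} (hε : 0 < ε) (hc : 0 < c)
    {ρ : FockSpace ι →L[ℂ] FockSpace ι} (hρ : IsDensityMatrix ρ)
    (hmom : ∀ k, numberMoment ε k ρ ≤ ENNReal.ofReal (c ^ k)) {p q : ℕ}
    (B : SymPow ι p →L[ℂ] SymPow ι q) :
    IsWickExtension ε ρ (Symbol.monomial B) (wickCutoff ε c B) := by
  have h : ρ.toLinearMap ∘ₗ (wickCutoff ε c B).toLinearMap ∘ₗ toFock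
      = ρ.toLinearMap ∘ₗ toFock ∘ₗ wick ε (Symbol.monomial B) := by
    refine DirectSum.linearMap_ext ℂ fun n => LinearMap.ext fun x => ?_
    change ρ (wickCutoff ε c B (toFock (DirectSum.lof ℂ ℕ (fun m => SymPow ι m) n x)))
      = ρ (toFock (wick ε (Symbol.monomial B) (DirectSum.lof ℂ ℕ (fun m => SymPow ι m) n x)))
    rw [wick_monomial_lof, toFock_lof, toFock_lof, wickCutoff_apply]
    have h0 : ∀ m ≠ n, wickSector ε B m ((lp.single 2 n x : FockSpace ι) m) = 0 := fun m hm => by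
      rw [lp.single_apply_ne _ _ _ hm, map_zero]
    by_cases hn : n ∈ cutoffSectors ε c p q
    · rw [Finset.sum_eq_single_of_mem n hn fun m _ hm => by rw [h0 m hm, lp.single_zero],
        lp.single_apply_self]
    · rw [Finset.sum_eq_zero fun m hm => by
        rw [h0 m (ne_of_mem_of_not_mem hm hn), lp.single_zero], map_zero]
      by_cases hp : p ≤ n
      · refine (apply_single_eq_zero hc hρ hmom ?_ _).symm
        by_contra! hle
        exact hn ((mem_cutoffSectors hε).2 ⟨hp, hle⟩)
      · rw [wickSector, dif_neg hp, zero_apply, lp.single_zero, map_zero]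
  exact fun ψ => congrArg (fun f => f ψ) h

theorem exists_isWickExtension {ε c : ℝ} (hε : 0 < ε) (hc : 0 < c)
    {ρ : FockSpace ι →L[ℂ] FockSpace ι} (hρ : IsDensityMatrix ρ)
    (hmom : ∀ k, numberMoment ε k ρ ≤ ENNReal.ofReal (c ^ k)) (b : Symbol ι) :
    ∃ K, IsWickExtension ε ρ b K := by
  induction b using DirectSum.induction_on with
  | zero => exact ⟨0, fun ψ => by simp [wick]⟩
  | of pq B => exact ⟨_, isWickExtension_wickCutoff hε hc hρ hmom B⟩
  | add b b' hb hb' =>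
    obtain ⟨K, hK⟩ := hb
    obtain ⟨K', hK'⟩ := hb'
    exact ⟨K + K', hK.add hK'⟩

theorem wickTrace_add {ε c : ℝ} (hε : 0 < ε) (hc : 0 < c)
    {ρ : FockSpace ι →L[ℂ] FockSpace ι} (hρ : IsDensityMatrix ρ)
    (hmom : ∀ k, numberMoment ε k ρ ≤ ENNReal.ofReal (c ^ k)) (b b' : Symbol ι) :
    wickTrace ε ρ (b + b') = wickTrace ε ρ b + wickTrace ε ρ b' := by
  obtain ⟨K, hK⟩ := exists_isWickExtension hε hc hρ hmom b
  obtain ⟨K', hK'⟩ := exists_isWickExtension hε hc hρ hmom b'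
  rw [hK.wickTrace_eq, hK'.wickTrace_eq, (hK.add hK').wickTrace_eq, trace_comp_add hρ.1 hρ.2]

theorem norm_wickTrace_monomial_le {ε c M : ℝ} (hε : 0 < ε) (hM : ε ≤ M) (hc : 0 < c)
    {ρ : FockSpace ι →L[ℂ] FockSpace ι} (hρ : IsDensityMatrix ρ)
    (hmom : ∀ k, numberMoment ε k ρ ≤ ENNReal.ofReal (c ^ k)) {p q : ℕ}
    (B : SymPow ι p →L[ℂ] SymPow ι q) :
    ‖wickTrace ε ρ (Symbol.monomial B)‖ ≤ √((c + M * p) ^ p * c ^ q) * ‖B‖ := by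
  rw [(isWickExtension_wickCutoff hε hc hρ hmom B).wickTrace_eq]
  exact (norm_trace_comp_le hρ.1 hρ.2 _).trans (norm_wickCutoff_le hε (by positivity) B
    fun n hn => norm_wickSector_le hε hM B hn)

variable {Z : Type*} [NormedAddCommGroup Z] [InnerProductSpace ℂ Z] [CompleteSpace Z]

/-- The Wick monomial of `B (1 - P^{⊗ p})` vanishes on the range of `Γ(P)`, so that its expectation
is controlled by `Tr[(1 - Γ(P)) ρ]`. -/
theorem norm_wickTrace_comp_one_sub_gammaSector_le (e : HilbertBasis ι ℂ Z) {P : Z →L[ℂ] Z}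
    (hP : IsStarProjection P) {ε c M : ℝ} (hε : 0 < ε) (hM : ε ≤ M) (hc : 0 < c)
    {ρ : FockSpace ι →L[ℂ] FockSpace ι} (hρ : IsDensityMatrix ρ)
    (hmom : ∀ k, numberMoment ε k ρ ≤ ENNReal.ofReal (c ^ k)) {p q : ℕ}
    (B : SymPow ι p →L[ℂ] SymPow ι q) :
    ‖wickTrace ε ρ (Symbol.monomial (B ∘L (1 - gammaSector e P p)))‖
      ≤ √((c + M * p) ^ p * c ^ q) * ‖B ∘L (1 - gammaSector e P p)‖
        * √(trace ((1 - Gamma e P hP.norm_le) ∘L ρ)).re := by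
  rw [(isWickExtension_wickCutoff hε hc hρ hmom _).wickTrace_eq]
  refine (norm_trace_comp_le_sqrt hρ.1 hρ.2 (isStarProjection_Gamma e hP).one_sub ?_).trans ?_
  · refine ContinuousLinearMap.ext fun ψ => ?_
    change wickCutoff ε c _ (ψ - Gamma e P hP.norm_le ψ) = _
    rw [map_sub, sub_eq_self, wickCutoff_apply]
    refine Finset.sum_eq_zero fun n _ => ?_
    change lp.single 2 (n - p + q) (wickSector ε _ n (gammaSector e P n (ψ n))) = 0
    rw [wickSector_comp_gammaSector e hP, lp.single_zero]
  · gcongr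
    exact norm_wickCutoff_le hε (by positivity) _ fun n hn => norm_wickSector_le hε hM _ hn

end Cutoff

open MeasureTheory Filter

/-! ### Approximation by finite rank projections -/

section Approximation

/-- In a separable Hilbert space there is a sequence of finite rank orthogonal projections that
converges strongly to the identity. -/
theorem exists_seq_isStarProjection_tendsto (W : Type*) [NormedAddCommGroup W]
    [InnerProductSpace ℂ W] [CompleteSpace W] [TopologicalSpace.SeparableSpace W] :
    ∃ Q : ℕ → W →L[ℂ] W, (∀ j, IsCompactOperator (Q j)) ∧ (∀ j, IsStarProjection (Q j)) ∧
      ∀ x, Tendsto (fun j => Q j x) atTop (𝓝 x) := by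
  let U : ℕ → Submodule ℂ W := fun j =>
    Submodule.span ℂ (TopologicalSpace.denseSeq W '' Set.Iic j)
  have hfin : ∀ j, FiniteDimensional ℂ (U j) := fun j =>
    FiniteDimensional.span_of_finite ℂ ((Set.finite_Iic j).image _)
  refine ⟨fun j => (U j).starProjection, fun j => ?_, fun j => isStarProjection_starProjection,
    fun x => Submodule.starProjection_tendsto_self U (fun i j hij => Submodule.span_mono
      (Set.image_mono (Set.Iic_subset_Iic.2 hij))) x ?_⟩
  · exact isCompactOperator_of_forall_mem _ (U j) fun x => (U j).starProjection_apply_mem x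
  · refine (Submodule.dense_iff_topologicalClosure_eq_top.1 ?_).ge
    refine (TopologicalSpace.denseRange_denseSeq W).mono ?_
    rintro _ ⟨j, rfl⟩
    exact (le_iSup U j) (Submodule.subset_span ⟨j, Set.mem_Iic.2 le_rfl, rfl⟩)

/-- Contractions that converge strongly to the identity do so in operator norm after composition
with a compact operator. -/
theorem eventually_norm_sub_comp_le {V W : Type*} [NormedAddCommGroup V] [NormedSpace ℂ V]
    [NormedAddCommGroup W] [NormedSpace ℂ W] {Q : ℕ → W →L[ℂ] W} (hQ : ∀ j, ‖Q j‖ ≤ 1)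
    (hlim : ∀ x, Tendsto (fun j => Q j x) atTop (𝓝 x)) {K : V →L[ℂ] W}
    (hK : IsCompactOperator K) {δ : ℝ} (hδ : 0 < δ) :
    ∀ᶠ j in atTop, ‖K - Q j ∘L K‖ ≤ δ := by
  obtain ⟨S, hS, hKS⟩ := hK.image_closedBall_subset_compact (𝕜₁ := ℂ) (f := K.toLinearMap) 1
  obtain ⟨t, ht, hSt⟩ := Metric.totallyBounded_iff.1 hS.totallyBounded (δ / 3) (by positivity)
  have hev : ∀ᶠ j in atTop, ∀ y ∈ t, ‖Q j y - y‖ < δ / 3 :=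
    (eventually_all_finite ht).2 fun y _ => by
      simpa [dist_eq_norm] using (Metric.tendsto_nhds.1 (hlim y)) (δ / 3) (by positivity)
  filter_upwards [hev] with j hj
  have hball : ∀ x : V, ‖x‖ ≤ 1 → ‖(K - Q j ∘L K) x‖ ≤ δ := fun x hx => by
    have hx' : K x ∈ S := hKS ⟨x, by simpa using hx, rfl⟩
    obtain ⟨y, hy, hxy⟩ := Set.mem_iUnion₂.1 (hSt hx')
    rw [Metric.mem_ball, dist_eq_norm] at hxy
    have h1 : (K - Q j ∘L K) x = (K x - y) - (Q j y - y) - Q j (K x - y) := by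
      simp only [sub_apply, ContinuousLinearMap.comp_apply, map_sub]
      abel
    have h2 : ‖Q j (K x - y)‖ ≤ ‖K x - y‖ := by
      simpa using (Q j).le_of_opNorm_le (hQ j) (K x - y)
    rw [h1]
    refine (norm_sub_le _ _).trans ?_
    have := norm_sub_le (K x - y) (Q j y - y)
    linarith [hj y hy]
  refine ContinuousLinearMap.opNorm_le_bound _ hδ.le fun x => ?_
  -- rescaling from the closed unit ball
  rcases eq_or_ne x 0 with rfl | hx
  · simp
  have hx0 : ‖x‖ ≠ 0 := norm_ne_zero_iff.2 hx
  have h1 := hball ((‖x‖⁻¹ : ℂ) • x) (by simp [norm_smul, hx0])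
  rw [map_smul, norm_smul, norm_inv, Complex.norm_real, norm_norm,
    inv_mul_le_iff₀ (norm_pos_iff.2 hx)] at h1
  linarith

/-- A bounded sequence of operators that converges strongly converges `σ`-weakly. -/
theorem tendsto_sigmaWeak {V W : Type*} [NormedAddCommGroup V] [InnerProductSpace ℂ V]
    [NormedAddCommGroup W] [InnerProductSpace ℂ W] {T : ℕ → V →L[ℂ] W} {C : ℝ}
    (hC : ∀ j, ‖T j‖ ≤ C) (hlim : ∀ x, Tendsto (fun j => T j x) atTop (𝓝 0)) :
    Tendsto T atTop (@nhds _ (sigmaWeak V W) 0) := by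
  rw [nhds_induced, tendsto_comap_iff, tendsto_pi_nhds]
  rintro ⟨x, y⟩
  have hx := (memℓp_gen_iff (p := 2) (by norm_num)).1 (lp.memℓp x)
  have hy := (memℓp_gen_iff (p := 2) (by norm_num)).1 (lp.memℓp y)
  have hxy := (Real.summable_and_inner_le_Lp_mul_Lq_tsum_of_nonneg Real.HolderConjugate.two_two
    (f := fun i => ‖x i‖) (g := fun i => ‖y i‖)
    (fun _ => norm_nonneg _) (fun _ => norm_nonneg _) (by simpa using hx) (by simpa using hy)).1
  refine tendsto_tsum_of_dominated_convergence (bound := fun k => C * (‖x k‖ * ‖y k‖))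
    (hxy.mul_left C) (fun k => ?_) (Eventually.of_forall fun j k => ?_)
  · exact ((innerSL ℂ (x k)).continuous.tendsto _).comp (hlim (y k))
  · refine (norm_inner_le_norm _ _).trans ?_
    calc ‖x k‖ * ‖T j (y k)‖ ≤ ‖x k‖ * (C * ‖y k‖) := by
          gcongr
          exact (T j).le_of_opNorm_le (hC j) _
      _ = C * (‖x k‖ * ‖y k‖) := by ring

end Approximation

/-! ### Symbols on separable spaces -/

variable {Z : Type*} [NormedAddCommGroup Z] [InnerProductSpace ℂ Z]

theorem countable_of_hilbertBasis [TopologicalSpace.SeparableSpace Z] (e : HilbertBasis ι ℂ Z) :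
    Countable ι := by
  refine Pairwise.countable_of_isOpen_disjoint (s := fun i => Metric.ball (e i) (1 / 2)) ?_
    (fun _ => Metric.isOpen_ball) fun i => ⟨e i, Metric.mem_ball_self (by norm_num)⟩
  intro i j hij
  refine Metric.ball_disjoint_ball ?_
  rw [dist_eq_norm]
  have h1 := norm_sub_sq (𝕜 := ℂ) (e i) (e j)
  rw [e.orthonormal.1 i, e.orthonormal.1 j, e.orthonormal.2 hij, map_zero] at h1
  nlinarith [norm_nonneg (e i - e j)]

theorem separableSpace_symPow [Countable ι] (n : ℕ) :
    TopologicalSpace.SeparableSpace (SymPow ι n) := by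
  classical
  have h1 : TopologicalSpace.SeparableSpace (TensorPow ι n) := by
    rw [← TopologicalSpace.isSeparable_univ_iff]
    have h2 := ((Set.countable_range fun i : Fin n → ι =>
      (lp.single 2 i (1 : ℂ) : TensorPow ι n)).isSeparable.span (R := ℂ)).closure
    refine h2.mono fun ψ _ => mem_closure_of_tendsto (lp.hasSum_single (by norm_num) ψ)
      (Eventually.of_forall fun s => Submodule.sum_mem _ fun i _ => ?_)
    have h3 : lp.single 2 i (ψ i) = ψ i • (lp.single 2 i (1 : ℂ) : TensorPow ι n) := by
      rw [← lp.single_smul, smul_eq_mul, mul_one]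
    rw [h3]
    exact Submodule.smul_mem _ _ (Submodule.subset_span ⟨i, rfl⟩)
  have h2 : SecondCountableTopology (TensorPow ι n) :=
    UniformSpace.secondCountable_of_separable _
  exact inferInstanceAs (TopologicalSpace.SeparableSpace (symSubmodule ι n))

theorem norm_tensorPower (e : HilbertBasis ι ℂ Z) (n : ℕ) (z : Z) :
    ‖tensorPower e n z‖ = ‖z‖ ^ n := by
  have h : inner ℂ (tensorPower e n z) (tensorPower e n z) = inner ℂ z z ^ n := by
    refine (inner_pureTensor _ _).trans ?_
    simp
  rw [inner_self_eq_norm_sq_to_K, inner_self_eq_norm_sq_to_K] at h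
  have h2 : ‖tensorPower e n z‖ ^ 2 = (‖z‖ ^ n) ^ 2 := by
    rw [← pow_mul, mul_comm, pow_mul]
    exact_mod_cast h
  exact (pow_left_inj₀ (norm_nonneg _) (by positivity) two_ne_zero).1 h2

theorem eval_monomial (e : HilbertBasis ι ℂ Z) {p q : ℕ} (B : SymPow ι p →L[ℂ] SymPow ι q)
    (z : Z) : (Symbol.monomial B).eval e z
      = inner ℂ (tensorPower e q z) (B (tensorPower e p z)) :=
  DirectSum.toModule_lof ℂ (M := fun pq : ℕ × ℕ => SymPow ι pq.1 →L[ℂ] SymPow ι pq.2)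
    (φ := fun pq : ℕ × ℕ =>
      { toFun := fun B : SymPow ι pq.1 →L[ℂ] SymPow ι pq.2 =>
          inner ℂ (tensorPower e pq.2 z) (B (tensorPower e pq.1 z))
        map_add' := fun B C => by simp only [add_apply, inner_add_right]
        map_smul' := fun a B => by
          simp only [smul_apply, inner_smul_right, RingHom.id_apply, smul_eq_mul] }) (p, q) B

theorem norm_eval_monomial_le (e : HilbertBasis ι ℂ Z) {p q : ℕ}
    (B : SymPow ι p →L[ℂ] SymPow ι q) (z : Z) :
    ‖(Symbol.monomial B).eval e z‖ ≤ ‖B‖ * ‖z‖ ^ (p + q) := by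
  rw [eval_monomial]
  calc _ ≤ ‖tensorPower e q z‖ * (‖B‖ * ‖tensorPower e p z‖) :=
        (norm_inner_le_norm _ _).trans (by gcongr; exact B.le_opNorm _)
    _ = ‖B‖ * ‖z‖ ^ (p + q) := by
        rw [norm_tensorPower, norm_tensorPower]
        ring

theorem isCompact_monomial {p q : ℕ} {B : SymPow ι p →L[ℂ] SymPow ι q}
    (hB : IsCompactOperator B) : (Symbol.monomial B).IsCompact := fun pq => by
  by_cases h : pq = (p, q)
  · subst h
    rw [Symbol.monomial, DirectSum.of_eq_same]
    exact hB
  · rw [Symbol.monomial, DirectSum.of_eq_of_ne _ _ _ h]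
    exact isCompactOperator_zero

variable [MeasurableSpace Z]

/-- By linearity it suffices to treat monomials. -/
theorem propertyP_of_monomial {e : HilbertBasis ι ℂ Z} {ε : ℕ → ℝ}
    {ρ : ℕ → FockSpace ι →L[ℂ] FockSpace ι} {μ : Measure Z} (hμ : IsWignerMeasure e ε ρ μ)
    (hadd : ∀ n (b b' : Symbol ι), wickTrace (ε n) (ρ n) (b + b')
      = wickTrace (ε n) (ρ n) b + wickTrace (ε n) (ρ n) b')
    (h : ∀ (p q : ℕ) (B : SymPow ι p →L[ℂ] SymPow ι q),
      WickConverges e ε ρ μ (Symbol.monomial B)) : PropertyP e ε ρ μ := fun b => by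
  induction b using DirectSum.induction_on with
  | zero => exact hμ.2 _ fun _ => isCompactOperator_zero
  | of pq B => exact h pq.1 pq.2 B
  | add b b' hb hb' =>
    have heval : Symbol.eval e (b + b') = Symbol.eval e b + Symbol.eval e b' := funext fun z => by
      simp [Symbol.eval]
    refine ⟨heval ▸ hb.1.add hb'.1, ?_⟩
    simp only [hadd, heval]
    rw [integral_add' hb.1 hb'.1]
    exact hb.2.add hb'.2

variable [BorelSpace Z]

/-! ### Passage to the limit -/

/-- All moments of the Wigner measure are finite: `‖z‖ ^ (2 k)` is the limit of the values of
compact symbols of norm at most one, whose expectations are bounded. -/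
theorem integrable_norm_pow [Countable ι] {e : HilbertBasis ι ℂ Z} {ε : ℕ → ℝ}
    {ρ : ℕ → FockSpace ι →L[ℂ] FockSpace ι} {μ : Measure Z} (hμ : IsWignerMeasure e ε ρ μ)
    (hbd : ∀ p q : ℕ, ∃ C : ℝ, 0 ≤ C ∧ ∀ n (B : SymPow ι p →L[ℂ] SymPow ι q),
      ‖wickTrace (ε n) (ρ n) (Symbol.monomial B)‖ ≤ C * ‖B‖) (k : ℕ) :
    Integrable (fun z => ‖z‖ ^ k) μ := by
  have := hμ.1
  have := separableSpace_symPow (ι := ι) k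
  obtain ⟨C, hC0, hC⟩ := hbd k k
  obtain ⟨Q, hQc, hQ, hQlim⟩ := exists_seq_isStarProjection_tendsto (SymPow ι k)
  have heval : ∀ j z, (Symbol.monomial (Q j)).eval e z
      = ((‖Q j (tensorPower e k z)‖ ^ 2 : ℝ) : ℂ) := fun j z => by
    have h1 : ContinuousLinearMap.adjoint (Q j) = Q j := (hQ j).isSelfAdjoint.star_eq
    have h2 : Q j (Q j (tensorPower e k z)) = Q j (tensorPower e k z) :=
      congrArg (fun f => f (tensorPower e k z)) (hQ j).isIdempotentElem.eq
    rw [eval_monomial, ← h2, inner_apply_of_adjoint_eq_self h1, inner_self_eq_norm_sq_to_K, h2]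
    norm_cast
  have hconv : ∀ j, WickConverges e ε ρ μ (Symbol.monomial (Q j)) := fun j =>
    hμ.2 _ (isCompact_monomial (hQc j))
  have hint : ∀ j, Integrable (fun z => ‖Q j (tensorPower e k z)‖ ^ 2) μ := fun j => by
    have h := (hconv j).1.re
    simpa only [heval, RCLike.ofReal_re, Complex.coe_algebraMap, RCLike.re_eq_complex_re,
      Complex.ofReal_re] using h
  have hle : ∀ j, ∫ z, ‖Q j (tensorPower e k z)‖ ^ 2 ∂μ ≤ C := fun j => by
    have h1 : ‖∫ z, (Symbol.monomial (Q j)).eval e z ∂μ‖ ≤ C :=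
      le_of_tendsto' (hconv j).2.norm fun n => (hC n (Q j)).trans
        (mul_le_of_le_one_right hC0 (hQ j).norm_le)
    simp only [heval] at h1
    rw [integral_complex_ofReal, Complex.norm_real] at h1
    exact (le_abs_self _).trans h1
  have hlim : ∀ z, Tendsto (fun j => ENNReal.ofReal (‖Q j (tensorPower e k z)‖ ^ 2)) atTop
      (𝓝 (ENNReal.ofReal (‖z‖ ^ (2 * k)))) := fun z => by
    rw [mul_comm, pow_mul, ← norm_tensorPower e]
    exact ENNReal.tendsto_ofReal ((hQlim _).norm.pow 2)
  have hfin : ∫⁻ z, ENNReal.ofReal (‖z‖ ^ (2 * k)) ∂μ ≤ ENNReal.ofReal C := by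
    calc ∫⁻ z, ENNReal.ofReal (‖z‖ ^ (2 * k)) ∂μ
        = ∫⁻ z, liminf (fun j => ENNReal.ofReal (‖Q j (tensorPower e k z)‖ ^ 2)) atTop ∂μ :=
          lintegral_congr fun z => (hlim z).liminf_eq.symm
      _ ≤ liminf (fun j => ∫⁻ z, ENNReal.ofReal (‖Q j (tensorPower e k z)‖ ^ 2) ∂μ) atTop :=
          lintegral_liminf_le' fun j => (hint j).aemeasurable.ennreal_ofReal
      _ ≤ liminf (fun _ : ℕ => ENNReal.ofReal C) atTop := by
          refine liminf_le_liminf (Eventually.of_forall fun j => ?_)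
          rw [← ofReal_integral_eq_lintegral_ofReal (hint j)
            (Eventually.of_forall fun _ => by positivity)]
          exact ENNReal.ofReal_le_ofReal (hle j)
      _ = ENNReal.ofReal C := liminf_const _
  have hint2 : Integrable (fun z => ‖z‖ ^ (2 * k)) μ :=
    (lintegral_ofReal_ne_top_iff_integrable
      (continuous_norm.pow _).measurable.aestronglyMeasurable
      (Eventually.of_forall fun _ => pow_nonneg (norm_nonneg _) _)).1
      (ne_top_of_le_ne_top ENNReal.ofReal_ne_top hfin)
  refine ((integrable_const (1 : ℝ)).add hint2).mono'
    (continuous_norm.pow _).measurable.aestronglyMeasurable (Eventually.of_forall fun z => ?_)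
  rw [norm_pow, norm_norm]
  change ‖z‖ ^ k ≤ 1 + ‖z‖ ^ (2 * k)
  rw [mul_comm, pow_mul]
  nlinarith [sq_nonneg (‖z‖ ^ k - 1), sq_nonneg (‖z‖ ^ k)]

/-- If the expectations of `B - Q j B` tend to zero uniformly along the sequence of states, for
compact contractions `Q j` converging strongly to the identity, then the convergence for the compact
symbols `Q j B` carries over to `B`. -/
theorem wickConverges_monomial [Countable ι] {e : HilbertBasis ι ℂ Z} {ε : ℕ → ℝ}
    {ρ : ℕ → FockSpace ι →L[ℂ] FockSpace ι} {μ : Measure Z} (hμ : IsWignerMeasure e ε ρ μ)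
    (hbd : ∀ p q : ℕ, ∃ C : ℝ, 0 ≤ C ∧ ∀ n (B : SymPow ι p →L[ℂ] SymPow ι q),
      ‖wickTrace (ε n) (ρ n) (Symbol.monomial B)‖ ≤ C * ‖B‖)
    (hadd : ∀ n (b b' : Symbol ι), wickTrace (ε n) (ρ n) (b + b')
      = wickTrace (ε n) (ρ n) b + wickTrace (ε n) (ρ n) b') {p q : ℕ}
    (B : SymPow ι p →L[ℂ] SymPow ι q) {Q : ℕ → SymPow ι q →L[ℂ] SymPow ι q}
    (hQc : ∀ j, IsCompactOperator (Q j)) (hQ : ∀ j, ‖Q j‖ ≤ 1)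
    (hQlim : ∀ x, Tendsto (fun j => Q j x) atTop (𝓝 x))
    (hunif : ∀ δ : ℝ, 0 < δ → ∀ᶠ j in atTop, ∀ n,
      ‖wickTrace (ε n) (ρ n) (Symbol.monomial (B - Q j ∘L B))‖ < δ) :
    WickConverges e ε ρ μ (Symbol.monomial B) := by
  have hconv : ∀ j, WickConverges e ε ρ μ (Symbol.monomial (Q j ∘L B)) := fun j =>
    hμ.2 _ (isCompact_monomial ((hQc j).comp_clm B))
  have hlim : ∀ z, Tendsto (fun j => (Symbol.monomial (Q j ∘L B)).eval e z) atTop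
      (𝓝 ((Symbol.monomial B).eval e z)) := fun z => by
    simp only [eval_monomial]
    exact ((innerSL ℂ (tensorPower e q z)).continuous.tendsto _).comp (hQlim _)
  have hdom : Integrable (fun z => ‖B‖ * ‖z‖ ^ (p + q)) μ :=
    (integrable_norm_pow hμ hbd (p + q)).const_mul _
  have hmeas : AEStronglyMeasurable ((Symbol.monomial B).eval e) μ :=
    aestronglyMeasurable_of_tendsto_ae atTop (fun j => (hconv j).1.aestronglyMeasurable)
      (Eventually.of_forall hlim)
  have hintlim : Tendsto (fun j => ∫ z, (Symbol.monomial (Q j ∘L B)).eval e z ∂μ) atTop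
      (𝓝 (∫ z, (Symbol.monomial B).eval e z ∂μ)) := by
    refine tendsto_integral_of_dominated_convergence _ (fun j => (hconv j).1.aestronglyMeasurable)
      hdom (fun j => Eventually.of_forall fun z => (norm_eval_monomial_le e _ z).trans ?_)
      (Eventually.of_forall hlim)
    gcongr
    refine ((Q j).opNorm_comp_le B).trans ?_
    exact mul_le_of_le_one_left (norm_nonneg B) (hQ j)
  refine ⟨hdom.mono' hmeas (Eventually.of_forall fun z => norm_eval_monomial_le e B z), ?_⟩
  have hU : TendstoUniformly (fun j n => wickTrace (ε n) (ρ n) (Symbol.monomial (Q j ∘L B)))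
      (fun n => wickTrace (ε n) (ρ n) (Symbol.monomial B)) atTop := by
    rw [Metric.tendstoUniformly_iff]
    intro δ hδ
    filter_upwards [hunif δ hδ] with j hj n
    have h : Symbol.monomial B
        = Symbol.monomial (B - Q j ∘L B) + Symbol.monomial (Q j ∘L B) := by
      rw [Symbol.monomial, Symbol.monomial, Symbol.monomial, ← map_add, sub_add_cancel]
    rw [dist_eq_norm, h, hadd, add_sub_cancel_right]
    exact hj n
  exact (hU.tendstoUniformlyOnFilter.mono_right le_top).tendsto_of_eventually_tendsto
    (Eventually.of_forall fun j => (hconv j).2) hintlim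

/-- `Q j B` tends to `B` in the `σ`-weak topology, where `(E)` gives uniform smallness. -/
theorem wickConverges_of_condE [Countable ι] {e : HilbertBasis ι ℂ Z} {ε : ℕ → ℝ}
    {ρ : ℕ → FockSpace ι →L[ℂ] FockSpace ι} {μ : Measure Z} (hμ : IsWignerMeasure e ε ρ μ)
    (hbd : ∀ p q : ℕ, ∃ C : ℝ, 0 ≤ C ∧ ∀ n (B : SymPow ι p →L[ℂ] SymPow ι q),
      ‖wickTrace (ε n) (ρ n) (Symbol.monomial B)‖ ≤ C * ‖B‖)
    (hadd : ∀ n (b b' : Symbol ι), wickTrace (ε n) (ρ n) (b + b')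
      = wickTrace (ε n) (ρ n) b + wickTrace (ε n) (ρ n) b')
    (hE : CondE ε ρ) {p q : ℕ} (B : SymPow ι p →L[ℂ] SymPow ι q) :
    WickConverges e ε ρ μ (Symbol.monomial B) := by
  have := separableSpace_symPow (ι := ι) q
  obtain ⟨Q, hQc, hQ, hQlim⟩ := exists_seq_isStarProjection_tendsto (SymPow ι q)
  refine wickConverges_monomial hμ hbd hadd B hQc (fun j => (hQ j).norm_le) hQlim fun δ hδ => ?_
  obtain ⟨W₀, hW₀, h⟩ := hE p q δ hδ
  have ht : Tendsto (fun j => B - Q j ∘L B) atTop (@nhds _ (sigmaWeak _ _) 0) := by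
    refine tendsto_sigmaWeak (C := ‖B‖ + ‖B‖) (fun j => ?_) fun x => ?_
    · refine (norm_sub_le _ _).trans (add_le_add_right (((Q j).opNorm_comp_le B).trans ?_) _)
      exact mul_le_of_le_one_left (norm_nonneg B) (hQ j).norm_le
    · simpa using (hQlim (B x)).const_sub (B x)
  filter_upwards [ht hW₀] with j hj n using h _ hj n

variable [CompleteSpace Z]

/-- Writing `B = B P^{⊗ p} + B (1 - P^{⊗ p})`, the compact operator `B P^{⊗ p}` is approximated by
`Q j B P^{⊗ p}` in norm, and the remainder is small by `(T)`, uniformly in `j` and in the state. -/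
theorem wickConverges_of_condT [Countable ι] {e : HilbertBasis ι ℂ Z} {ε : ℕ → ℝ}
    {ρ : ℕ → FockSpace ι →L[ℂ] FockSpace ι} {μ : Measure Z} (hμ : IsWignerMeasure e ε ρ μ)
    (hbd : ∀ p q : ℕ, ∃ C : ℝ, 0 ≤ C ∧ ∀ n (B : SymPow ι p →L[ℂ] SymPow ι q),
      ‖wickTrace (ε n) (ρ n) (Symbol.monomial B)‖ ≤ C * ‖B‖ ∧
      ∀ (P : Z →L[ℂ] Z) (hP : IsStarProjection P),
        ‖wickTrace (ε n) (ρ n) (Symbol.monomial (B ∘L (1 - gammaSector e P p)))‖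
          ≤ C * ‖B ∘L (1 - gammaSector e P p)‖ * √(trace ((1 - Gamma e P hP.norm_le) ∘L ρ n)).re)
    (hadd : ∀ n (b b' : Symbol ι), wickTrace (ε n) (ρ n) (b + b')
      = wickTrace (ε n) (ρ n) b + wickTrace (ε n) (ρ n) b')
    (hT : CondT e ρ) {p q : ℕ} (B : SymPow ι p →L[ℂ] SymPow ι q) :
    WickConverges e ε ρ μ (Symbol.monomial B) := by
  have := separableSpace_symPow (ι := ι) q
  obtain ⟨Q, hQc, hQ, hQlim⟩ := exists_seq_isStarProjection_tendsto (SymPow ι q)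
  refine wickConverges_monomial hμ (fun p q => (hbd p q).imp fun C hC =>
    ⟨hC.1, fun n B => (hC.2 n B).1⟩) hadd B hQc (fun j => (hQ j).norm_le) hQlim fun δ hδ => ?_
  obtain ⟨C, hC0, hC⟩ := hbd p q
  -- the summand `1` makes `D` positive
  set D := C * (2 * ‖B‖ * 2) + 1 with hD
  have hDpos : 0 < D := by positivity
  obtain ⟨P, hP, hfin, hη⟩ := hT ((δ / 2 / D) ^ 2) (by positivity)
  have hΓ : ‖1 - gammaSector e P p‖ ≤ 2 :=
    ContinuousLinearMap.opNorm_le_bound _ zero_le_two fun x => by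
      refine (norm_sub_le _ _).trans ?_
      have := norm_gammaSector_apply_le e hP.norm_le p x
      change ‖x‖ + ‖gammaSector e P p x‖ ≤ 2 * ‖x‖
      linarith
  have hQB : ∀ j, ‖B - Q j ∘L B‖ ≤ 2 * ‖B‖ := fun j => by
    have h1 := ((Q j).opNorm_comp_le B).trans
      (mul_le_of_le_one_left (norm_nonneg B) (hQ j).norm_le)
    linarith [norm_sub_le B (Q j ∘L B)]
  filter_upwards [eventually_norm_sub_comp_le (K := B ∘L gammaSector e P p)
    (fun j => (hQ j).norm_le) hQlim ((isCompactOperator_gammaSector e P p).clm_comp B)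
    (δ := δ / 2 / (C + 1))
    (by positivity)] with j hj n
  have hsplit : Symbol.monomial (B - Q j ∘L B)
      = Symbol.monomial (B ∘L gammaSector e P p - Q j ∘L (B ∘L gammaSector e P p))
        + Symbol.monomial ((B - Q j ∘L B) ∘L (1 - gammaSector e P p)) := by
    rw [Symbol.monomial, Symbol.monomial, Symbol.monomial, ← map_add]
    congr 1
    refine ContinuousLinearMap.ext fun x => ?_
    simp
  rw [hsplit, hadd]
  have h1 : ‖wickTrace (ε n) (ρ n) (Symbol.monomial
      (B ∘L gammaSector e P p - Q j ∘L (B ∘L gammaSector e P p)))‖ ≤ C * (δ / 2 / (C + 1)) :=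
    (hC n _).1.trans (mul_le_mul_of_nonneg_left hj hC0)
  have h2 : ‖wickTrace (ε n) (ρ n) (Symbol.monomial
      ((B - Q j ∘L B) ∘L (1 - gammaSector e P p)))‖ ≤ C * (2 * ‖B‖ * 2) * (δ / 2 / D) := by
    refine ((hC n _).2 P hP).trans ?_
    gcongr
    · refine (ContinuousLinearMap.opNorm_comp_le _ _).trans ?_
      gcongr
      exact hQB j
    · exact Real.sqrt_le_iff.2 ⟨by positivity, (hη n).le⟩
  have h3 : C * (δ / 2 / (C + 1)) ≤ δ / 2 := by
    rw [← mul_div_assoc, div_le_iff₀ (by positivity)]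
    nlinarith
  have h4 : C * (2 * ‖B‖ * 2) * (δ / 2 / D) < δ / 2 := by
    rw [← mul_div_assoc, div_lt_iff₀ hDpos, hD]
    nlinarith
  linarith [norm_add_le (wickTrace (ε n) (ρ n) (Symbol.monomial
      (B ∘L gammaSector e P p - Q j ∘L (B ∘L gammaSector e P p))))
    (wickTrace (ε n) (ρ n) (Symbol.monomial ((B - Q j ∘L B) ∘L (1 - gammaSector e P p))))]

end Fock

end

theorem lemma3p1 {Z : Type*} [NormedAddCommGroup Z] [InnerProductSpace ℂ Z] [CompleteSpace Z]
    [TopologicalSpace.SeparableSpace Z] [MeasurableSpace Z] [BorelSpace Z]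
    {ι : Type*} (e : HilbertBasis ι ℂ Z)
    (ε : ℕ → ℝ) (hε : ∀ n, 0 < ε n) (hε_lim : Filter.Tendsto ε Filter.atTop (𝓝 0))
    (ρ : ℕ → Fock.FockSpace ι →L[ℂ] Fock.FockSpace ι) (hρ : ∀ n, Fock.IsDensityMatrix (ρ n))
    (μ : MeasureTheory.Measure Z) (hμ : Fock.IsWignerMeasure e ε ρ μ)
    (hH0 : Fock.CondH0 ε ρ) :
    (Fock.CondT e ρ → Fock.PropertyP e ε ρ μ) ∧ (Fock.CondE ε ρ → Fock.PropertyP e ε ρ μ) := by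
  have := Fock.countable_of_hilbertBasis e
  obtain ⟨c, hc, hmom⟩ := hH0
  obtain ⟨M, hM⟩ := hε_lim.bddAbove_range
  have hM' : ∀ n, ε n ≤ M := fun n => hM ⟨n, rfl⟩
  have hadd := fun n => Fock.wickTrace_add (hε n) hc (hρ n) fun k => hmom k n
  refine ⟨fun hT => Fock.propertyP_of_monomial hμ hadd fun p q B =>
    Fock.wickConverges_of_condT hμ (fun p q => ⟨_, Real.sqrt_nonneg _, fun n B =>
      ⟨Fock.norm_wickTrace_monomial_le (hε n) (hM' n) hc (hρ n) (fun k => hmom k n) B,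
        fun P hP => Fock.norm_wickTrace_comp_one_sub_gammaSector_le e hP (hε n) (hM' n) hc (hρ n)
          (fun k => hmom k n) B⟩⟩) hadd hT B,
    fun hE => Fock.propertyP_of_monomial hμ hadd fun p q B =>
    Fock.wickConverges_of_condE hμ (fun p q => ⟨_, Real.sqrt_nonneg _, fun n B =>
      Fock.norm_wickTrace_monomial_le (hε n) (hM' n) hc (hρ n) (fun k => hmom k n) B⟩)
      hadd hE B⟩
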